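/- **Setting (gang of bandits).** There are $n$ users, forming the nodes of a fixed graph $G$, and user $i$ has an unknown preference vector $w_i^*\in\mathbb{R}^d$ with $\|w_i^*\|_2\le 1$. Let $L=L_G+I_n$, where $L_G=D^{-1/2}(D-A)D^{-1/2}$ is the normalized Laplacian of $G$ ($D$ the degree matrix, $A$ the adjacency matrix; rows and columns of isolated nodes are zero). In each round $t$ a target user $i_t$ and a set $\mathcal{C}_t$ of $K$ items with feature vectors $x_{t,j}\in\mathbb{R}^d$, $\|x_{t,j}\|_2\le 1$, are drawn; the pairs $(i_t,\mathcal{C}_t)$ are identically distributed and each is independent of the past. The recommended item $j_t$ receives the rating $r_t=\langle w^*_{i_t},x_{t,j_t}\rangle+\eta_{t,j_t}$; all ratings $\langle w^*_{i_t},x_{t,j}\rangle+\eta_{t,j}$ lie in $[0,1]$, and, conditionally on the past observations and on $(i_t,\mathcal{C}_t)$, the noise $\eta_{t,j}$ has mean zero and is $\sigma$-sub-Gaussian for some $\sigma>0$. The regret after $T$ rounds is $$R(T)=\sum_{t=1}^T\Big[\max_{j\in\mathcal{C}_t}\langle w^*_{i_t},x_{t,j}\rangle-\langle w^*_{i_t},x_{t,j_t}\rangle\Big].$$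 **Epoch-greedy.** Fix $\lambda>0$ and $\delta\in(0,1)$. Epoch $q=1,2,\dots$ consists of one exploration round, in which $j_t$ is drawn uniformly from $\mathcal{C}_t$ with fresh randomness, followed by $$s_q=\Big\lfloor \frac{1}{\mathrm{Err}(q)}\Big\rfloor,\qquad \mathrm{Err}(q)=\frac{1}{\sqrt q}\left[\sqrt{\frac{48\,\mathrm{Tr}(L^{-1})}{\lambda}}+\sqrt{\frac{9\ln(2/\delta)}{2}}\right],$$ exploitation rounds, in which $j_t$ maximizes $\langle w_{i_t,t},x_{t,j}\rangle$ over $j\in\mathcal{C}_t$. Here the estimate $w_t=(w_{1,t},\dots,w_{n,t})\in\mathbb{R}^{dn}$ minimizes $$\sum_{\tau<t,\ \tau\text{ exploration round}}\big(\langle w_{i_\tau},x_{\tau,j_\tau}\rangle-r_\tau\big)^2+\lambda\,w^{T}(L\otimes I_d)\,w .$$ **Theorem.** For all $d$, $K$ and $\lambda_{\max}$ there is a constant $C>0$, depending only on $d$, $K$ and $\lambda_{\max}$, such that for every $n$, $G$, $\lambda\in(0,\lambda_{\max}]$, $\delta\in(0,1)$, $\sigma>0$ and every such gang-of-bandits problem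 in which almost surely $\|w_{i,t}\|_2\le 1$ for all users $i$ and all rounds $t$, the regret of epoch-greedy satisfies, for every $T$, $$\mathbb{E}[R(T)]\le C\,\big(\ln(2/\delta)\big)^{1/3}\; n^{1/3}\left(\frac{\mathrm{Tr}(L^{-1})}{\lambda n}\right)^{1/3}T^{2/3},$$ that is, $\mathbb{E}[R(T)]=\tilde O\big(n^{1/3}(\mathrm{Tr}(L^{-1})/(\lambda n))^{1/3}T^{2/3}\big)$. -/

import Mathlib

open MeasureTheory ProbabilityTheory
open scoped Kronecker

/-- The normalized Laplacian `D^{-1/2} (D - A) D^{-1/2}` of the graph of users, with the usual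
convention that the row and the column of an isolated user vanish (here `(√0)⁻¹ = 0`). -/
noncomputable def normalizedLaplacian {n : ℕ} (G : SimpleGraph (Fin n)) :
    Matrix (Fin n) (Fin n) ℝ := by
  classical
  exact Matrix.diagonal (fun i => (Real.sqrt (G.degree i))⁻¹) * G.lapMatrix ℝ *
    Matrix.diagonal (fun i => (Real.sqrt (G.degree i))⁻¹)

/-- The (invertible) matrix `L = L_G + I_n` used for the Laplacian regularization. -/
noncomputable def gobLaplacian {n : ℕ} (G : SimpleGraph (Fin n)) : Matrix (Fin n) (Fin n) ℝ :=
  normalizedLaplacian G + 1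

/-- The concatenation in `ℝ^{dn}` of one vector of `ℝ^d` for each of the `n` users. -/
def stack {n d : ℕ} (w : Fin n → EuclideanSpace ℝ (Fin d)) : Fin n × Fin d → ℝ :=
  fun p => w p.1 p.2

/-- The regularizer `wᵀ (L ⊗ I_d) w`. -/
noncomputable def laplacianPenalty {n d : ℕ} (L : Matrix (Fin n) (Fin n) ℝ)
    (w : Fin n → EuclideanSpace ℝ (Fin d)) : ℝ :=
  dotProduct (stack w) ((L ⊗ₖ (1 : Matrix (Fin d) (Fin d) ℝ)).mulVec (stack w))

/-- The rating that the target user of round `t` gives to the available item `j`, in the linear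
model: the true preference of that user applied to the features of the item, plus noise. -/
noncomputable def rating {Ω : Type*} {n d K : ℕ} (wstar : Fin n → EuclideanSpace ℝ (Fin d))
    (user : ℕ → Ω → Fin n) (x : ℕ → Ω → Fin K → EuclideanSpace ℝ (Fin d))
    (η : ℕ → Ω → Fin K → ℝ) (t : ℕ) (ω : Ω) (j : Fin K) : ℝ :=
  inner ℝ (wstar (user t ω)) (x t ω j) + η t ω j

/-- What has been seen of round `t` when it is over: the target user, the features of the available
items, the recommended item and the rating of the recommended item. -/
noncomputable def observation {Ω : Type*} {n d K : ℕ} (wstar : Fin n → EuclideanSpace ℝ (Fin d))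
    (user : ℕ → Ω → Fin n) (x : ℕ → Ω → Fin K → EuclideanSpace ℝ (Fin d))
    (η : ℕ → Ω → Fin K → ℝ) (item : ℕ → Ω → Fin K) (t : ℕ) (ω : Ω) :
    Fin n × (Fin K → EuclideanSpace ℝ (Fin d)) × Fin K × ℝ :=
  (user t ω, x t ω, item t ω, rating wstar user x η t ω (item t ω))

/-- The σ-algebra of everything observed in the rounds before `t`. -/
noncomputable abbrev history {Ω : Type*} {n d K : ℕ} (wstar : Fin n → EuclideanSpace ℝ (Fin d))
    (user : ℕ → Ω → Fin n) (x : ℕ → Ω → Fin K → EuclideanSpace ℝ (Fin d))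
    (η : ℕ → Ω → Fin K → ℝ) (item : ℕ → Ω → Fin K) (t : ℕ) : MeasurableSpace Ω :=
  ⨆ τ : ℕ, ⨆ _ : τ < t,
    MeasurableSpace.comap (observation wstar user x η item τ) inferInstance

/-- The σ-algebra generated by the target user and the available items of round `t`. -/
abbrev context {Ω : Type*} {n d K : ℕ} (user : ℕ → Ω → Fin n)
    (x : ℕ → Ω → Fin K → EuclideanSpace ℝ (Fin d)) (t : ℕ) : MeasurableSpace Ω :=
  MeasurableSpace.comap (fun ω => (user t ω, x t ω)) inferInstance

/-- The stochastic gang-of-bandits model with `n` users and `K` available items with features in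
`ℝ^d` per round. The items recommended so far enter through the history only. -/
structure IsGangOfBandits {Ω : Type*} [MeasurableSpace Ω] (μ : Measure Ω) {n d K : ℕ} (σ : ℝ)
    (wstar : Fin n → EuclideanSpace ℝ (Fin d)) (user : ℕ → Ω → Fin n)
    (x : ℕ → Ω → Fin K → EuclideanSpace ℝ (Fin d)) (η : ℕ → Ω → Fin K → ℝ)
    (item : ℕ → Ω → Fin K) : Prop where
  measurable_user : ∀ t, Measurable (user t)
  measurable_features : ∀ t, Measurable (x t)
  measurable_noise : ∀ t, Measurable (η t)
  /-- True preferences and features have Euclidean norm at most one. -/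
  norm_wstar_le : ∀ i, ‖wstar i‖ ≤ 1
  norm_features_le : ∀ t, ∀ᵐ ω ∂μ, ∀ j, ‖x t ω j‖ ≤ 1
  /-- Ratings are in `[0, 1]`. -/
  rating_mem : ∀ t, ∀ᵐ ω ∂μ, ∀ j, rating wstar user x η t ω j ∈ Set.Icc (0 : ℝ) 1
  /-- The pairs (target user, available items) have the same law in all rounds, and the pair of a
  round is independent of the past. -/
  identDistrib : ∀ t, IdentDistrib (fun ω => (user t ω, x t ω)) (fun ω => (user 0 ω, x 0 ω)) μ μ
  indep_history : ∀ t, Indep (context user x t) (history wstar user x η item t) μ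
  /-- The noise is conditionally centred and conditionally sub-Gaussian. -/
  sigma_pos : 0 < σ
  noise_centred : ∀ t j,
    μ[fun ω => η t ω j | history wstar user x η item t ⊔ context user x t] =ᵐ[μ] 0
  noise_subGaussian : ∀ t j (γ : ℝ),
    μ[fun ω => Real.exp (γ * η t ω j) | history wstar user x η item t ⊔ context user x t]
      ≤ᵐ[μ] fun _ => Real.exp (γ ^ 2 * σ ^ 2 / 2)

/-- The bound on the generalization error after `q` exploration rounds (at confidence `1 - δ`) with
which epoch-greedy is tuned. -/
noncomputable def errBound {n : ℕ} (L : Matrix (Fin n) (Fin n) ℝ) (lam δ : ℝ) (q : ℕ) : ℝ :=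
  (Real.sqrt (48 * (L⁻¹).trace / lam) + Real.sqrt (9 * Real.log (2 / δ) / 2)) / Real.sqrt q

/-- The number `s_q` of exploitation rounds in epoch `q`, for `q = 1, 2, …`. -/
noncomputable def exploitSteps {n : ℕ} (L : Matrix (Fin n) (Fin n) ℝ) (lam δ : ℝ) (q : ℕ) : ℕ :=
  ⌊1 / errBound L lam δ q⌋₊

/-- The first round of epoch `q + 1`, where rounds are numbered from `0` on and the epochs
`1, 2, …` follow each other, epoch `p` having `1 + s_p` rounds. -/
noncomputable def epochStart {n : ℕ} (L : Matrix (Fin n) (Fin n) ℝ) (lam δ : ℝ) (q : ℕ) : ℕ :=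
  ∑ p ∈ Finset.range q, (1 + exploitSteps L lam δ (p + 1))

/-- Each epoch consists of one exploration round followed by its exploitation rounds. -/
def IsExploration {n : ℕ} (L : Matrix (Fin n) (Fin n) ℝ) (lam δ : ℝ) (t : ℕ) : Prop :=
  ∃ q, t = epochStart L lam δ q

open Classical in
/-- The Laplacian-regularized least-squares objective, on the feedback from the exploration rounds
before round `t`, as a function of candidate preference vectors `w` of all users. -/
noncomputable def objective {Ω : Type*} {n d K : ℕ} (L : Matrix (Fin n) (Fin n) ℝ) (lam δ : ℝ)
    (wstar : Fin n → EuclideanSpace ℝ (Fin d)) (user : ℕ → Ω → Fin n)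
    (x : ℕ → Ω → Fin K → EuclideanSpace ℝ (Fin d)) (η : ℕ → Ω → Fin K → ℝ)
    (item : ℕ → Ω → Fin K) (t : ℕ) (ω : Ω) (w : Fin n → EuclideanSpace ℝ (Fin d)) : ℝ :=
  (∑ τ ∈ (Finset.range t).filter (IsExploration L lam δ),
    (inner ℝ (w (user τ ω)) (x τ ω (item τ ω)) - rating wstar user x η τ ω (item τ ω)) ^ 2)
  + lam * laplacianPenalty L w

/-- The items `item` are recommended by epoch-greedy, with estimates `west t ω i ∈ ℝ^d` of the
preference vector of user `i` at round `t`. -/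
structure IsEpochGreedy {Ω : Type*} [MeasurableSpace Ω] (μ : Measure Ω) {n d K : ℕ}
    (L : Matrix (Fin n) (Fin n) ℝ) (lam δ : ℝ)
    (wstar : Fin n → EuclideanSpace ℝ (Fin d)) (user : ℕ → Ω → Fin n)
    (x : ℕ → Ω → Fin K → EuclideanSpace ℝ (Fin d)) (η : ℕ → Ω → Fin K → ℝ)
    (item : ℕ → Ω → Fin K) (west : ℕ → Ω → Fin n → EuclideanSpace ℝ (Fin d)) : Prop where
  measurable_item : ∀ t, Measurable (item t)
  /-- The estimates minimize the regularized least-squares objective. -/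
  estimate : ∀ t ω, IsMinOn (objective L lam δ wstar user x η item t ω) Set.univ (west t ω)
  /-- In an exploration round the item is drawn uniformly from the available ones, with fresh
  randomness. -/
  explore_uniform : ∀ t, IsExploration L lam δ t →
    ∀ j, μ {ω | item t ω = j} = (K : ENNReal)⁻¹
  explore_indep : ∀ t, IsExploration L lam δ t →
    Indep (MeasurableSpace.comap (item t) inferInstance)
      (history wstar user x η item t ⊔ context user x t ⊔
        MeasurableSpace.comap (η t) inferInstance) μ
  /-- In an exploitation round the item has the highest estimated rating (ties are broken in any
  measurable way). -/
  exploit : ∀ t, ¬ IsExploration L lam δ t → ∀ ω j,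
    inner ℝ (west t ω (user t ω)) (x t ω j) ≤
      inner ℝ (west t ω (user t ω)) (x t ω (item t ω))

/-- The regret after `T` rounds. -/
noncomputable def regret {Ω : Type*} {n d K : ℕ} (wstar : Fin n → EuclideanSpace ℝ (Fin d))
    (user : ℕ → Ω → Fin n) (x : ℕ → Ω → Fin K → EuclideanSpace ℝ (Fin d))
    (item : ℕ → Ω → Fin K) (T : ℕ) (ω : Ω) : ℝ :=
  ∑ t ∈ Finset.range T,
    ((⨆ j : Fin K, inner ℝ (wstar (user t ω)) (x t ω j))
      - inner ℝ (wstar (user t ω)) (x t ω (item t ω)))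

/-!
Epoch-greedy after `q` exploration rounds is ridge regression in `ℝ^{dn}`, with regularizer
`A = λ L ⊗ I`, on `q` i.i.d. feature vectors `φ = eᵢ ⊗ x`. Everything rests on a bound of order
`(d n + λ n) / q`, free of logarithms, for its expected squared prediction error at a fresh `φ`.

Let `M` be the regularized Gram matrix of the `q` training points *and* the fresh point `y`, let
`p = M⁻¹ y`, and let `h = yᵀ M⁻¹ y ≤ 1` be the leverage of `y`. The error `D` of the estimate at `y`
satisfies `(1 - h) D = ∑ₛ εₛ ⟨p, φₛ⟩ - yᵀ M⁻¹ A θ` (`one_sub_leverage_mul_error`). Since the true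
and the estimated preferences have norm at most one, `|D| ≤ 2`, so that `D²` is at most `4` times
the square of the right-hand side plus `8 h` (`sq_error_le_freshErrorBound`). The expectations of
the terms are bounded as follows.

* The matrix `M` is symmetric in the `q + 1` exchangeable points, the leverages of which sum to at
  most the dimension; hence `E h ≤ d n / (q + 1)`. In the same way the squared bias has expectation
  at most `θᵀ A θ / (q + 1)` (`integral_snoc_le_of_sum_le`).
* The noise is only a martingale difference sequence, but later features are independent of the
  past, so the noise terms remain uncorrelated given all features
  (`IsAdaptedSample.integral_features_mul_noise`). As the noise is bounded by `2`, the noise part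
  has second moment at most `4 E ∑ₛ ⟨p, φₛ⟩² ≤ 4 E h`.

The regret of a greedy choice is at most twice the largest prediction error over the `K` items. The
quadratic form of `L` lies between one and three times the Euclidean one, whence `Tr L⁻¹ ≥ n / 3`,
so `(d n + λ n) / q` is at most a constant times `Err(q)²` and an exploitation round of epoch `q`
has expected regret `O(Err(q))`. An epoch then costs `O(1)`, having at most `1 / Err(q)` such rounds
(`sum_integral_roundRegret_le`). Finally, the first `q` epochs last at least `(2/3) q^{3/2} / a`
rounds, where `Err(q) = a / √q`, so at most `3 (a T)^{2/3}` epochs begin before time `T`.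
-/

/-! ### Ridge regression: leverages and the prediction error at a held-out point -/

/-- The regularized Gram matrix `A + ∑ₛ Φₛ Φₛᵀ` of a family of feature vectors. -/
noncomputable def regGram {ι κ : Type*} [Fintype κ] (A : Matrix ι ι ℝ) (Φ : κ → ι → ℝ) :
    Matrix ι ι ℝ :=
  A + ∑ s, Matrix.vecMulVec (Φ s) (Φ s)

/-- The ridge leverage `Φₛᵀ (A + ∑ Φ Φᵀ)⁻¹ Φₛ` of the sample `s`. -/
noncomputable def leverage {ι κ : Type*} [Fintype ι] [DecidableEq ι] [Fintype κ]
    (A : Matrix ι ι ℝ) (Φ : κ → ι → ℝ) (s : κ) : ℝ :=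
  Φ s ⬝ᵥ (regGram A Φ)⁻¹.mulVec (Φ s)

section RidgeRegression

variable {ι κ : Type*} [Fintype ι] [Fintype κ] {A : Matrix ι ι ℝ}

lemma dotProduct_regGram_mulVec (A : Matrix ι ι ℝ) (Φ : κ → ι → ℝ) (v u : ι → ℝ) :
    v ⬝ᵥ (regGram A Φ).mulVec u = v ⬝ᵥ A.mulVec u + ∑ s, (Φ s ⬝ᵥ u) * (Φ s ⬝ᵥ v) := by
  simp only [regGram, Matrix.add_mulVec, Matrix.sum_mulVec, Matrix.vecMulVec_mulVec,
    dotProduct_add, dotProduct_sum]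
  congr 1
  refine Finset.sum_congr rfl fun s _ => ?_
  simp [dotProduct_comm v (Φ s)]

lemma posDef_regGram (hA : A.PosDef) (Φ : κ → ι → ℝ) : (regGram A Φ).PosDef := by
  refine hA.add_posSemidef (Matrix.posSemidef_sum _ fun s _ => ?_)
  simpa using Matrix.posSemidef_vecMulVec_self_star (Φ s)

lemma Matrix.IsHermitian.dotProduct_mulVec_comm {M : Matrix ι ι ℝ} (hM : M.IsHermitian)
    (u v : ι → ℝ) : u ⬝ᵥ M.mulVec v = v ⬝ᵥ M.mulVec u := by
  have h : M.transpose = M := by simpa using hM.eq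
  rw [dotProduct_comm, ← Matrix.vecMul_transpose, h, Matrix.dotProduct_mulVec]

/-- The normal equation of ridge regression, tested against a direction `v`. -/
lemma ridge_normal_equation (hA : A.IsHermitian) (Φ : κ → ι → ℝ) (y : κ → ℝ) {θ : ι → ℝ}
    (hθ : ∀ θ', ∑ s, (θ ⬝ᵥ Φ s - y s) ^ 2 + θ ⬝ᵥ A.mulVec θ ≤
      ∑ s, (θ' ⬝ᵥ Φ s - y s) ^ 2 + θ' ⬝ᵥ A.mulVec θ') (v : ι → ℝ) :
    ∑ s, (θ ⬝ᵥ Φ s - y s) * (Φ s ⬝ᵥ v) + v ⬝ᵥ A.mulVec θ = 0 := by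
  set c := ∑ s, (θ ⬝ᵥ Φ s - y s) * (Φ s ⬝ᵥ v) + v ⬝ᵥ A.mulVec θ with hc
  set a := ∑ s, (Φ s ⬝ᵥ v) ^ 2 + v ⬝ᵥ A.mulVec v with ha
  have key : ∀ u : ℝ, 0 ≤ a * (u * u) + 2 * c * u + 0 := by
    intro u
    have h := hθ (θ + u • v)
    have h1 : ∑ s, ((θ + u • v) ⬝ᵥ Φ s - y s) ^ 2 = ∑ s, (θ ⬝ᵥ Φ s - y s) ^ 2 +
        2 * u * ∑ s, (θ ⬝ᵥ Φ s - y s) * (Φ s ⬝ᵥ v) + u ^ 2 * ∑ s, (Φ s ⬝ᵥ v) ^ 2 := by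
      rw [Finset.mul_sum, Finset.mul_sum, ← Finset.sum_add_distrib, ← Finset.sum_add_distrib]
      refine Finset.sum_congr rfl fun s _ => ?_
      rw [add_dotProduct, smul_dotProduct, dotProduct_comm v, smul_eq_mul]
      ring
    have h2 : (θ + u • v) ⬝ᵥ A.mulVec (θ + u • v) = θ ⬝ᵥ A.mulVec θ +
        2 * u * (v ⬝ᵥ A.mulVec θ) + u ^ 2 * (v ⬝ᵥ A.mulVec v) := by
      have h4 := hA.dotProduct_mulVec_comm θ v
      simp only [Matrix.mulVec_add, Matrix.mulVec_smul, add_dotProduct, smul_dotProduct,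
        dotProduct_add, dotProduct_smul, smul_eq_mul, h4]
      ring
    rw [h1, h2] at h
    rw [hc, ha]
    linarith
  have := discrim_le_zero key
  rw [discrim] at this
  nlinarith [sq_nonneg c]

variable [DecidableEq ι]

lemma Matrix.PosDef.mulVec_inv_mulVec {M : Matrix ι ι ℝ} (hM : M.PosDef) (v : ι → ℝ) :
    M.mulVec (M⁻¹.mulVec v) = v := by
  have h : IsUnit M.det := (Matrix.isUnit_iff_isUnit_det _).1 hM.isUnit
  rw [Matrix.mulVec_mulVec, Matrix.mul_nonsing_inv _ h, Matrix.one_mulVec]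

lemma leverage_nonneg (hA : A.PosDef) (Φ : κ → ι → ℝ) (s : κ) : 0 ≤ leverage A Φ s := by
  simpa [leverage] using (posDef_regGram hA Φ).inv.posSemidef.dotProduct_mulVec_nonneg (Φ s)

lemma sum_sq_dotProduct_inv_mulVec_le (hA : A.PosDef) (Φ : κ → ι → ℝ) (s : κ) :
    ∑ r, (Φ r ⬝ᵥ (regGram A Φ)⁻¹.mulVec (Φ s)) ^ 2 ≤ leverage A Φ s := by
  set p := (regGram A Φ)⁻¹.mulVec (Φ s) with hp
  have h1 : p ⬝ᵥ (regGram A Φ).mulVec p = leverage A Φ s := by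
    rw [hp, (posDef_regGram hA Φ).mulVec_inv_mulVec, dotProduct_comm]; rfl
  have h2 : 0 ≤ p ⬝ᵥ A.mulVec p := by
    simpa using hA.posSemidef.dotProduct_mulVec_nonneg p
  rw [dotProduct_regGram_mulVec] at h1
  simp only [pow_two]
  linarith

lemma leverage_le_one (hA : A.PosDef) (Φ : κ → ι → ℝ) (s : κ) : leverage A Φ s ≤ 1 := by
  have h := sum_sq_dotProduct_inv_mulVec_le hA Φ s
  have h2 : leverage A Φ s ^ 2 ≤ ∑ r, (Φ r ⬝ᵥ (regGram A Φ)⁻¹.mulVec (Φ s)) ^ 2 :=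
    Finset.single_le_sum (f := fun r => (Φ r ⬝ᵥ (regGram A Φ)⁻¹.mulVec (Φ s)) ^ 2)
      (fun _ _ => sq_nonneg _) (Finset.mem_univ s)
  nlinarith [leverage_nonneg hA Φ s]

/-- The leverages sum to at most the dimension: their sum is `Tr (M⁻¹ (M - A))`, where `M` is the
regularized Gram matrix. -/
lemma sum_leverage_le (hA : A.PosDef) (Φ : κ → ι → ℝ) :
    ∑ s, leverage A Φ s ≤ Fintype.card ι := by
  have hM := posDef_regGram hA Φ
  have hu : IsUnit (regGram A Φ).det := (Matrix.isUnit_iff_isUnit_det _).1 hM.isUnit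
  have h1 : ∑ s, leverage A Φ s =
      ((regGram A Φ)⁻¹ * ∑ s, Matrix.vecMulVec (Φ s) (Φ s)).trace := by
    rw [Matrix.mul_sum, Matrix.trace_sum]
    refine Finset.sum_congr rfl fun s _ => ?_
    rw [Matrix.mul_vecMulVec, Matrix.trace_vecMulVec, dotProduct_comm]
    rfl
  have h2 : ∑ s, Matrix.vecMulVec (Φ s) (Φ s) = regGram A Φ - A := by simp [regGram]
  have h3 : 0 ≤ ((regGram A Φ)⁻¹ * A).trace := by
    obtain ⟨B, hB⟩ : ∃ B : Matrix ι ι ℝ, A = B.conjTranspose * B := by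
      open scoped MatrixOrder in
      exact CStarAlgebra.nonneg_iff_eq_star_mul_self.1 hA.posSemidef.nonneg
    have h4 := (hM.inv.posSemidef.mul_mul_conjTranspose_same B).trace_nonneg
    rwa [Matrix.mul_assoc, Matrix.trace_mul_comm, Matrix.mul_assoc, ← hB] at h4
  rw [h1, h2, Matrix.mul_sub, Matrix.nonsing_inv_mul _ hu, Matrix.trace_sub, Matrix.trace_one]
  linarith

/-- The bias of ridge regression on the sample: the noiseless ridge estimate of `θ` is off by
`M⁻¹ A θ`, where `M` is the regularized Gram matrix. -/
lemma sum_sq_dotProduct_bias_le (hA : A.PosDef) (Φ : κ → ι → ℝ) (θ : ι → ℝ) :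
    ∑ s, (Φ s ⬝ᵥ (regGram A Φ)⁻¹.mulVec (A.mulVec θ)) ^ 2 ≤ θ ⬝ᵥ A.mulVec θ := by
  set b := (regGram A Φ)⁻¹.mulVec (A.mulVec θ) with hb
  have h1 : b ⬝ᵥ (regGram A Φ).mulVec b = b ⬝ᵥ A.mulVec θ := by
    nth_rewrite 2 [hb]
    rw [(posDef_regGram hA Φ).mulVec_inv_mulVec]
  rw [dotProduct_regGram_mulVec] at h1
  have h2 : 0 ≤ (b - θ) ⬝ᵥ A.mulVec (b - θ) := by
    simpa using hA.posSemidef.dotProduct_mulVec_nonneg (b - θ)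
  have h3 : 0 ≤ b ⬝ᵥ A.mulVec b := by
    simpa using hA.posSemidef.dotProduct_mulVec_nonneg b
  have h4 := hA.isHermitian.dotProduct_mulVec_comm θ b
  rw [Matrix.mulVec_sub, sub_dotProduct, dotProduct_sub, dotProduct_sub] at h2
  have h5 : 0 ≤ ∑ s, (Φ s ⬝ᵥ b) * (Φ s ⬝ᵥ b) :=
    Finset.sum_nonneg fun _ _ => mul_self_nonneg _
  simp only [pow_two]
  linarith

/-- The error of the ridge estimate `θ'` at a held-out point `Φ o`, damped by one minus the leverage
of that point, is a combination of noise and bias in which the Gram matrix is the one of *all*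
points, the held-out one included (`Φ (e s)` are the training points). -/
lemma one_sub_leverage_mul_error {κ' : Type*} [Fintype κ'] (hA : A.PosDef) (Φ : κ → ι → ℝ)
    (o : κ) (e : κ' → κ) (hsum : ∀ f : κ → ℝ, ∑ s, f s = ∑ s, f (e s) + f o)
    (θ θ' : ι → ℝ) (ε : κ' → ℝ)
    (hθ' : ∀ v, ∑ s, (θ' ⬝ᵥ Φ (e s) - (θ ⬝ᵥ Φ (e s) + ε s)) * (Φ (e s) ⬝ᵥ v)
      + v ⬝ᵥ A.mulVec θ' = 0) :
    (1 - leverage A Φ o) * ((θ' - θ) ⬝ᵥ Φ o) =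
      ∑ s, ε s * (Φ (e s) ⬝ᵥ (regGram A Φ)⁻¹.mulVec (Φ o))
        - Φ o ⬝ᵥ (regGram A Φ)⁻¹.mulVec (A.mulVec θ) := by
  have hM := posDef_regGram hA Φ
  set p := (regGram A Φ)⁻¹.mulVec (Φ o) with hp
  have h0 : leverage A Φ o = Φ o ⬝ᵥ p := rfl
  have h1 : (θ' - θ) ⬝ᵥ (regGram A Φ).mulVec p = (θ' - θ) ⬝ᵥ Φ o := by
    rw [hp, hM.mulVec_inv_mulVec]
  have h2 := hθ' p
  rw [hM.inv.isHermitian.dotProduct_mulVec_comm (Φ o), ← hp,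
    dotProduct_comm (A.mulVec θ) p]
  rw [dotProduct_regGram_mulVec, hsum, hA.isHermitian.dotProduct_mulVec_comm,
    Matrix.mulVec_sub, dotProduct_sub] at h1
  have h3 : ∑ s, (θ' ⬝ᵥ Φ (e s) - (θ ⬝ᵥ Φ (e s) + ε s)) * (Φ (e s) ⬝ᵥ p) =
      ∑ s, (Φ (e s) ⬝ᵥ p) * (Φ (e s) ⬝ᵥ (θ' - θ)) - ∑ s, ε s * (Φ (e s) ⬝ᵥ p) := by
    rw [← Finset.sum_sub_distrib]
    refine Finset.sum_congr rfl fun s _ => ?_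
    rw [dotProduct_sub, dotProduct_comm θ', dotProduct_comm θ]
    ring
  rw [h3] at h2
  rw [dotProduct_comm (Φ o) (θ' - θ)] at h1
  rw [h0]
  linear_combination h2 - h1

end RidgeRegression

/-! ### Exchangeability of i.i.d. samples -/

section Exchangeability

variable {E : Type*} [MeasurableSpace E]

lemma measurable_snoc {q : ℕ} :
    Measurable (fun z : (Fin q → E) × E => (Fin.snoc z.1 z.2 : Fin (q + 1) → E)) := by
  refine measurable_pi_iff.2 fun i => ?_
  refine Fin.lastCases ?_ (fun j => ?_) i
  · simpa using measurable_snd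
  · simpa using! (measurable_pi_apply j).comp measurable_fst

lemma map_snoc_pi_prod (ν : Measure E) [IsProbabilityMeasure ν] (q : ℕ) :
    ((Measure.pi fun _ : Fin q => ν).prod ν).map
      (fun z => (Fin.snoc z.1 z.2 : Fin (q + 1) → E)) = Measure.pi fun _ => ν := by
  refine (Measure.pi_eq fun s hs => ?_).symm
  rw [Measure.map_apply measurable_snoc (MeasurableSet.univ_pi hs)]
  have : (fun z : (Fin q → E) × E => (Fin.snoc z.1 z.2 : Fin (q + 1) → E)) ⁻¹' Set.univ.pi s =
      (Set.univ.pi fun i => s i.castSucc) ×ˢ s (Fin.last q) := by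
    ext z
    simp [Set.mem_pi, Fin.forall_fin_succ']
  rw [this, Measure.prod_prod, Measure.pi_pi, Fin.prod_univ_castSucc]

lemma integral_comp_perm_pi (ν : Measure E) [IsProbabilityMeasure ν] {q : ℕ}
    (σ : Equiv.Perm (Fin q)) (f : (Fin q → E) → ℝ) :
    ∫ Φ, f (Φ ∘ σ) ∂Measure.pi (fun _ => ν) = ∫ Φ, f Φ ∂Measure.pi (fun _ => ν) := by
  have h := measurePreserving_piCongrLeft (fun _ : Fin q => ν) σ
  rw [← h.integral_comp']
  congr 1
  ext Φ
  congr 1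
  ext i
  exact MeasurableEquiv.piCongrLeft_apply_apply σ (β := fun _ => E) Φ i

/-- If the statistics `g s` of `q + 1` i.i.d. points are permuted when the points are, then each of
them has at most a `q + 1`-st part of any bound on their sum; here this is said of the last one. -/
lemma integral_snoc_le_of_sum_le (ν : Measure E) [IsProbabilityMeasure ν] {q : ℕ}
    {g : (Fin (q + 1) → E) → Fin (q + 1) → ℝ} {B : ℝ} (hg : ∀ s, Measurable fun Φ => g Φ s)
    (h0 : ∀ Φ s, 0 ≤ g Φ s) (hperm : ∀ (σ : Equiv.Perm (Fin (q + 1))) Φ s, g (Φ ∘ σ) s = g Φ (σ s))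
    (hB : ∀ Φ, ∑ s, g Φ s ≤ B) :
    ∫ z : (Fin q → E) × E, g (Fin.snoc z.1 z.2) (Fin.last q)
      ∂(Measure.pi fun _ : Fin q => ν).prod ν ≤ B / (q + 1) := by
  have hint : ∀ s, Integrable (fun Φ => g Φ s) (Measure.pi fun _ => ν) := fun s =>
    Integrable.of_bound (hg s).aestronglyMeasurable B <| Filter.Eventually.of_forall fun Φ => by
      rw [Real.norm_of_nonneg (h0 Φ s)]
      exact (Finset.single_le_sum (fun r _ => h0 Φ r) (Finset.mem_univ s)).trans (hB Φ)
  have h1 : ∀ s, ∫ Φ, g Φ s ∂Measure.pi (fun _ => ν) =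
      ∫ Φ, g Φ (Fin.last q) ∂Measure.pi (fun _ => ν) := by
    intro s
    rw [← integral_comp_perm_pi ν (Equiv.swap s (Fin.last q))]
    simp [hperm]
  have h2 : ∫ z : (Fin q → E) × E, g (Fin.snoc z.1 z.2) (Fin.last q)
      ∂(Measure.pi fun _ : Fin q => ν).prod ν = ∫ Φ, g Φ (Fin.last q) ∂Measure.pi (fun _ => ν) := by
    rw [← map_snoc_pi_prod ν q,
      integral_map measurable_snoc.aemeasurable (hg _).aestronglyMeasurable]
  have h3 : ∫ Φ, ∑ s, g Φ s ∂Measure.pi (fun _ : Fin (q + 1) => ν) ≤ B := by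
    refine (integral_mono (integrable_finsetSum _ fun s _ => hint s) (integrable_const B)
      hB).trans ?_
    simp
  rw [integral_finsetSum _ fun s _ => hint s, Finset.sum_congr rfl fun s _ => h1 s] at h3
  rw [h2, le_div_iff₀ (by positivity)]
  simpa [mul_comm] using h3

end Exchangeability

section RidgeMeasurability

variable {ι κ : Type*} [Fintype κ]

lemma continuous_regGram (A : Matrix ι ι ℝ) :
    Continuous fun Φ : κ → ι → ℝ => regGram A Φ := by
  unfold regGram
  refine continuous_const.add (continuous_finsetSum _ fun s _ => ?_)
  exact (continuous_apply s).matrix_vecMulVec (continuous_apply s)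

lemma regGram_comp_perm (A : Matrix ι ι ℝ) (Φ : κ → ι → ℝ) (σ : Equiv.Perm κ) :
    regGram A (Φ ∘ σ) = regGram A Φ := by
  simp only [regGram, Function.comp]
  rw [Equiv.sum_comp σ fun s => Matrix.vecMulVec (Φ s) (Φ s)]

variable [Fintype ι] [DecidableEq ι]

lemma measurable_regGram_inv_apply (A : Matrix ι ι ℝ) (i j : ι) :
    Measurable fun Φ : κ → ι → ℝ => (regGram A Φ)⁻¹ i j := by
  simp only [Matrix.inv_def, Ring.inverse_eq_inv', Matrix.smul_apply, smul_eq_mul]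
  exact (continuous_regGram A).matrix_det.measurable.inv.mul
    ((continuous_regGram A).matrix_adjugate.matrix_elem i j).measurable

lemma measurable_dotProduct_regGram_inv_mulVec (A : Matrix ι ι ℝ) {α : Type*} [MeasurableSpace α]
    {Φ : α → κ → ι → ℝ} {u v : α → ι → ℝ} (hΦ : Measurable Φ) (hu : Measurable u)
    (hv : Measurable v) :
    Measurable fun a => u a ⬝ᵥ (regGram A (Φ a))⁻¹.mulVec (v a) := by
  have h : ∀ i j, Measurable fun a => (regGram A (Φ a))⁻¹ i j := fun i j =>
    (measurable_regGram_inv_apply A i j).comp hΦ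
  simp only [dotProduct, Matrix.mulVec]
  exact Finset.measurable_sum _ fun i _ => ((measurable_pi_apply i).comp hu).mul <|
    Finset.measurable_sum _ fun j _ => (h i j).mul ((measurable_pi_apply j).comp hv)

/-- The expected leverage of the last of `q + 1` i.i.d. points. -/
lemma integral_leverage_snoc_le {A : Matrix ι ι ℝ} (hA : A.PosDef) (ν : Measure (ι → ℝ))
    [IsProbabilityMeasure ν] (q : ℕ) :
    ∫ z : (Fin q → ι → ℝ) × (ι → ℝ),
      leverage A (Fin.snoc z.1 z.2 : Fin (q + 1) → ι → ℝ) (Fin.last q)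
      ∂(Measure.pi fun _ : Fin q => ν).prod ν ≤ Fintype.card ι / (q + 1) := by
  refine integral_snoc_le_of_sum_le ν (g := fun Φ s => leverage A Φ s) (fun s => ?_)
    (leverage_nonneg hA) (fun σ Φ s => ?_) (sum_leverage_le hA)
  · exact measurable_dotProduct_regGram_inv_mulVec A measurable_id (measurable_pi_apply s)
      (measurable_pi_apply s)
  · simp [leverage, regGram_comp_perm]

/-- The expected squared bias of the ridge prediction at the last of `q + 1` i.i.d. points. -/
lemma integral_sq_bias_snoc_le {A : Matrix ι ι ℝ} (hA : A.PosDef) (ν : Measure (ι → ℝ))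
    [IsProbabilityMeasure ν] (q : ℕ) (θ : ι → ℝ) :
    ∫ z : (Fin q → ι → ℝ) × (ι → ℝ),
      (z.2 ⬝ᵥ (regGram A (Fin.snoc z.1 z.2 : Fin (q + 1) → ι → ℝ))⁻¹.mulVec (A.mulVec θ)) ^ 2
      ∂(Measure.pi fun _ : Fin q => ν).prod ν ≤ (θ ⬝ᵥ A.mulVec θ) / (q + 1) := by
  have h := integral_snoc_le_of_sum_le ν (q := q)
    (g := fun Φ s => (Φ s ⬝ᵥ (regGram A Φ)⁻¹.mulVec (A.mulVec θ)) ^ 2) (fun s => ?_)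
    (fun _ _ => sq_nonneg _) (fun σ Φ s => ?_) (fun Φ => sum_sq_dotProduct_bias_le hA Φ θ)
  · simpa using h
  · exact (measurable_dotProduct_regGram_inv_mulVec A measurable_id (measurable_pi_apply s)
      measurable_const).pow_const 2
  · simp [regGram_comp_perm]

end RidgeMeasurability

/-! ### Martingale noise is uncorrelated given the whole i.i.d. design -/

/-- A sequence of feature vectors `Y s` and noise terms `ε s`, revealed along the filtration `𝓕`:
each feature vector has law `ν` and is independent of the past `𝓕 s`, and each noise term is bounded
by `b` and centred given the past and the present feature vector. The last condition is stated by
testing against bounded functions `f ω (Y s ω)`, with `f` measurable for `𝓕 s` in `ω`. -/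
structure IsAdaptedSample {Ω E : Type*} {m0 : MeasurableSpace Ω} [MeasurableSpace E]
    (μ : Measure Ω) (ν : Measure E) (b : ℝ) (𝓕 : ℕ → MeasurableSpace Ω) (Y : ℕ → Ω → E)
    (ε : ℕ → Ω → ℝ) : Prop where
  le : ∀ s, 𝓕 s ≤ m0
  mono : Monotone 𝓕
  measurable_feature : ∀ s, Measurable[𝓕 (s + 1)] (Y s)
  measurable_noise : ∀ s, Measurable[𝓕 (s + 1)] (ε s)
  map_feature : ∀ s, μ.map (Y s) = ν
  indep : ∀ s, Indep (𝓕 s) (MeasurableSpace.comap (Y s) inferInstance) μ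
  noise_bound : ∀ s, ∀ᵐ ω ∂μ, |ε s ω| ≤ b
  noise_centred : ∀ s (f : Ω → E → ℝ),
    Measurable[(𝓕 s).prod inferInstance] (Function.uncurry f) →
    (∃ C, ∀ᵐ ω ∂μ, ∀ y, |f ω y| ≤ C) → ∫ ω, f ω (Y s ω) * ε s ω ∂μ = 0

lemma ProbabilityTheory.Indep.map_prodMk {Ω E α : Type*} {m m0 : MeasurableSpace Ω}
    [MeasurableSpace E] [MeasurableSpace α] {μ : Measure Ω} [IsProbabilityMeasure μ]
    {X : Ω → α} {Y : Ω → E} (hle : m ≤ m0) (hX : Measurable[m] X) (hY : Measurable Y)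
    (h : Indep m (MeasurableSpace.comap Y inferInstance) μ) :
    μ.map (fun ω => (X ω, Y ω)) = (μ.map X).prod (μ.map Y) := by
  have hX' : Measurable X := hX.mono hle le_rfl
  refine (indepFun_iff_map_prod_eq_prod_map_map hX'.aemeasurable hY.aemeasurable).1 ?_
  exact indep_of_indep_of_le_left h hX.comap_le

namespace IsAdaptedSample

lemma snoc_features {Ω E : Type*} (Y : ℕ → Ω → E) (r : ℕ) (ω : Ω) :
    (fun i : Fin (r + 1) => Y i ω) = Fin.snoc (fun i : Fin r => Y i ω) (Y r ω) := by
  ext i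
  refine Fin.lastCases ?_ (fun j => ?_) i <;> simp

variable {Ω E : Type*} {m0 : MeasurableSpace Ω} [MeasurableSpace E]
  {μ : Measure Ω} {ν : Measure E} {b : ℝ}
  {𝓕 : ℕ → MeasurableSpace Ω} {Y : ℕ → Ω → E} {ε : ℕ → Ω → ℝ}

lemma measurable_feature' (h : IsAdaptedSample μ ν b 𝓕 Y ε) (s : ℕ) : Measurable (Y s) :=
  (h.measurable_feature s).mono (h.le _) le_rfl

lemma measurable_noise' (h : IsAdaptedSample μ ν b 𝓕 Y ε) (s : ℕ) : Measurable (ε s) :=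
  (h.measurable_noise s).mono (h.le _) le_rfl

lemma ae_forall_noise_le (h : IsAdaptedSample μ ν b 𝓕 Y ε) : ∀ᵐ ω ∂μ, ∀ s, |ε s ω| ≤ b :=
  ae_all_iff.2 h.noise_bound

lemma measurable_noises' (h : IsAdaptedSample μ ν b 𝓕 Y ε) (q : ℕ) :
    Measurable (fun ω (i : Fin q) => ε i ω) :=
  measurable_pi_iff.2 fun i => h.measurable_noise' i

lemma measurable_features (h : IsAdaptedSample μ ν b 𝓕 Y ε) (r : ℕ) :
    Measurable[𝓕 r] (fun ω (i : Fin r) => Y i ω) :=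
  @measurable_pi_lambda _ _ _ (𝓕 r) _ _ fun i =>
    (h.measurable_feature i).mono (h.mono i.2) le_rfl

lemma measurable_features' (h : IsAdaptedSample μ ν b 𝓕 Y ε) (r : ℕ) :
    Measurable (fun ω (i : Fin r) => Y i ω) :=
  (h.measurable_features r).mono (h.le _) le_rfl

variable [IsProbabilityMeasure μ] [IsProbabilityMeasure ν]

/-- The features are i.i.d. -/
lemma map_features (h : IsAdaptedSample μ ν b 𝓕 Y ε) (r : ℕ) :
    μ.map (fun ω (i : Fin r) => Y i ω) = Measure.pi fun _ => ν := by
  induction r with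
  | zero =>
    rw [Measure.pi_of_empty _ (fun i : Fin 0 => i.elim0)]
    have : (fun ω (i : Fin 0) => Y i ω) = fun _ => fun i : Fin 0 => i.elim0 := by
      ext ω i; exact i.elim0
    rw [this, Measure.map_const]
    simp
  | succ r ih =>
    have h1 := (h.indep r).map_prodMk (h.le r) (h.measurable_features r) (h.measurable_feature' r)
    rw [ih, h.map_feature] at h1
    rw [← map_snoc_pi_prod ν r, ← h1, Measure.map_map measurable_snoc
      ((h.measurable_features' r).prodMk (h.measurable_feature' r))]
    congr 1
    ext1 ω
    exact snoc_features Y r ω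

lemma map_features_prod (h : IsAdaptedSample μ ν b 𝓕 Y ε) (q : ℕ) :
    (μ.prod ν).map (fun z => ((fun i : Fin q => Y i z.1), z.2)) =
      (Measure.pi fun _ : Fin q => ν).prod ν := by
  rw [← h.map_features q]
  conv_rhs => rw [← Measure.map_id (μ := ν)]
  rw [Measure.map_prod_map _ _ (h.measurable_features' q) measurable_id]
  rfl

/-- Noise is centred given the past and *all* features, the later ones included, since the latter
are independent of what precedes them. -/
lemma integral_features_mul_noise (h : IsAdaptedSample μ ν b 𝓕 Y ε) {s : ℕ} {G : Ω → ℝ} {CG : ℝ}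
    (hG : Measurable[𝓕 s] G) (hGb : ∀ᵐ ω ∂μ, |G ω| ≤ CG) {r : ℕ} (hr : s + 1 ≤ r) :
    ∀ (F : (Fin r → E) → ℝ) (CF : ℝ), Measurable F → (∀ z, |F z| ≤ CF) →
      ∫ ω, F (fun i => Y i ω) * (G ω * ε s ω) ∂μ = 0 := by
  induction r, hr using Nat.le_induction with
  | base =>
    intro F CF hF hFb
    have h1 := h.noise_centred s (fun ω y => F (Fin.snoc (fun i : Fin s => Y i ω) y) * G ω) ?_ ?_
    · simp only [snoc_features Y s, ← mul_assoc]
      exact h1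
    · let _ := 𝓕 s
      have h2 : Measurable fun z : Ω × E =>
          (Fin.snoc (fun i : Fin s => Y i z.1) z.2 : Fin (s + 1) → E) :=
        measurable_snoc.comp
          (((h.measurable_features s).comp measurable_fst).prodMk measurable_snd)
      exact (hF.comp h2).mul (hG.comp measurable_fst)
    · refine ⟨CF * CG, ?_⟩
      filter_upwards [hGb] with ω hω y
      rw [abs_mul]
      exact mul_le_mul (hFb _) hω (abs_nonneg _) ((abs_nonneg _).trans (hFb (fun i => Y i ω)))
  | succ r hr ih =>
    intro F CF hF hFb
    have hGε : Measurable[𝓕 r] fun ω => G ω * ε s ω := by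
      let _ := 𝓕 r
      exact (hG.mono (h.mono (by omega)) le_rfl).mul
        ((h.measurable_noise s).mono (h.mono hr) le_rfl)
    have hX : Measurable[𝓕 r] fun ω => ((fun i : Fin r => Y i ω), G ω * ε s ω) := by
      let _ := 𝓕 r
      exact (h.measurable_features r).prodMk hGε
    have hX' : Measurable fun ω => ((fun i : Fin r => Y i ω), G ω * ε s ω) :=
      hX.mono (h.le r) le_rfl
    have hmap := (h.indep r).map_prodMk (h.le r) hX (h.measurable_feature' r)
    rw [h.map_feature] at hmap
    set X := fun ω => ((fun i : Fin r => Y i ω), G ω * ε s ω) with hXdef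
    have hΨ : Measurable fun z : ((Fin r → E) × ℝ) × E => F (Fin.snoc z.1.1 z.2) * z.1.2 :=
      (hF.comp (measurable_snoc.comp ((measurable_fst.comp measurable_fst).prodMk
        measurable_snd))).mul (measurable_snd.comp measurable_fst)
    have hint : Integrable (fun z : ((Fin r → E) × ℝ) × E => F (Fin.snoc z.1.1 z.2) * z.1.2)
        ((μ.map X).prod ν) := by
      rw [← hmap, integrable_map_measure hΨ.aestronglyMeasurable
        (hX'.prodMk (h.measurable_feature' r)).aemeasurable]
      refine Integrable.of_bound
        (hΨ.comp (hX'.prodMk (h.measurable_feature' r))).aestronglyMeasurable (CF * (CG * b)) ?_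
      filter_upwards [hGb, h.noise_bound s] with ω h1 h2
      simp only [Function.comp, hXdef, norm_mul, Real.norm_eq_abs]
      have h3 := (abs_nonneg _).trans (hFb (fun i => Y i ω))
      have h4 := (abs_nonneg _).trans h1
      gcongr
      exact hFb _
    have e1 : ∫ ω, F (fun i => Y i ω) * (G ω * ε s ω) ∂μ =
        ∫ z, F (Fin.snoc z.1.1 z.2) * z.1.2 ∂((μ.map X).prod ν) := by
      rw [← hmap, integral_map (hX'.prodMk (h.measurable_feature' r)).aemeasurable
        hΨ.aestronglyMeasurable]
      simp only [snoc_features Y r, hXdef]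
    rw [e1, integral_prod_symm _ hint]
    refine integral_eq_zero_of_ae (Filter.Eventually.of_forall fun y => ?_)
    have hy : Measurable fun z : Fin r → E => F (Fin.snoc z y) :=
      hF.comp (measurable_snoc.comp (measurable_id.prodMk measurable_const))
    have h1 := ih (fun z => F (Fin.snoc z y)) CF hy (fun z => hFb _)
    exact (integral_map hX'.aemeasurable ((hy.comp measurable_fst).mul
      measurable_snd).aestronglyMeasurable).trans h1

/-- Second moment of a noise sum with coefficients that depend on all features: the cross terms
vanish. -/
lemma integral_sq_sum_noise_le (h : IsAdaptedSample μ ν b 𝓕 Y ε) {q : ℕ}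
    (c : Fin q → (Fin q → E) → ℝ) {C : ℝ} (hc : ∀ s, Measurable (c s)) (hC : ∀ s z, |c s z| ≤ C) :
    ∫ ω, (∑ s : Fin q, ε s ω * c s (fun i => Y i ω)) ^ 2 ∂μ ≤
      b ^ 2 * ∫ z, ∑ s, c s z ^ 2 ∂Measure.pi fun _ : Fin q => ν := by
  have hYm := h.measurable_features' q
  have hcY : ∀ s, Measurable fun ω => c s (fun i => Y i ω) := fun s => (hc s).comp hYm
  have hb : ∀ s r : Fin q, ∀ᵐ ω ∂μ, ‖(ε s ω * c s (fun i => Y i ω)) *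
      (ε r ω * c r (fun i => Y i ω))‖ ≤ (b * C) * (b * C) := by
    intro s r
    filter_upwards [h.noise_bound s, h.noise_bound r] with ω h1 h2
    have h3 := (abs_nonneg _).trans h1
    have h4 := (abs_nonneg _).trans (hC s (fun i => Y i ω))
    simp only [norm_mul, Real.norm_eq_abs]
    gcongr
    · exact hC _ _
    · exact hC _ _
  have hint : ∀ s r : Fin q, Integrable (fun ω => (ε s ω * c s (fun i => Y i ω)) *
      (ε r ω * c r (fun i => Y i ω))) μ := fun s r =>
    Integrable.of_bound (((h.measurable_noise' s).mul (hcY s)).mul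
      ((h.measurable_noise' r).mul (hcY r))).aestronglyMeasurable _ (hb s r)
  have hlt : ∀ s r : Fin q, s < r → ∫ ω, (ε s ω * c s (fun i => Y i ω)) *
      (ε r ω * c r (fun i => Y i ω)) ∂μ = 0 := by
    intro s r hsr
    have h1 := h.integral_features_mul_noise (s := r) (G := ε s)
      ((h.measurable_noise s).mono (h.mono hsr) le_rfl) (h.noise_bound s) r.2
      (fun z => c s z * c r z) (C * C) ((hc s).mul (hc r)) (fun z => by
        rw [abs_mul]
        exact mul_le_mul (hC _ _) (hC _ _) (abs_nonneg _) ((abs_nonneg _).trans (hC s z)))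
    rw [← h1]
    congr 1
    ext ω
    ring
  have hne : ∀ s r : Fin q, r ≠ s → ∫ ω, (ε s ω * c s (fun i => Y i ω)) *
      (ε r ω * c r (fun i => Y i ω)) ∂μ = 0 := by
    intro s r hsr
    rcases lt_or_gt_of_ne hsr with h1 | h1
    · rw [← hlt r s h1]
      congr 1
      ext ω
      ring
    · exact hlt s r h1
  simp only [pow_two (∑ s : Fin q, _), Finset.sum_mul_sum]
  rw [integral_finsetSum _ fun s _ => integrable_finsetSum _ fun r _ => hint s r]
  have hcint : ∀ s, Integrable (fun z => c s z ^ 2) (Measure.pi fun _ : Fin q => ν) := fun s =>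
    Integrable.of_bound ((hc s).pow_const 2).aestronglyMeasurable (C ^ 2) <|
      Filter.Eventually.of_forall fun z => by
        rw [norm_pow, Real.norm_eq_abs]
        exact pow_le_pow_left₀ (abs_nonneg _) (hC s z) 2
  rw [integral_finsetSum _ fun s _ => hcint s, Finset.mul_sum]
  refine Finset.sum_le_sum fun s _ => ?_
  rw [integral_finsetSum _ fun r _ => hint s r,
    Finset.sum_eq_single s (fun r _ hr => hne s r hr) (by simp), ← h.map_features q,
    integral_map hYm.aemeasurable ((hc s).pow_const 2).aestronglyMeasurable,
    ← integral_const_mul]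
  have hcint' : Integrable (fun ω => c s (fun i => Y i ω) ^ 2) μ := by
    have := hcint s
    rw [← h.map_features q] at this
    exact (integrable_map_measure ((hc s).pow_const 2).aestronglyMeasurable hYm.aemeasurable).1 this
  refine integral_mono_ae (hint s s) (hcint'.const_mul _) ?_
  filter_upwards [h.noise_bound s] with ω h1
  have h2 : ε s ω ^ 2 ≤ b ^ 2 := sq_le_sq' (by linarith [neg_abs_le (ε s ω)])
    ((le_abs_self _).trans h1)
  calc _ = ε s ω ^ 2 * c s (fun i => Y i ω) ^ 2 := by ring
    _ ≤ _ := by gcongr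

end IsAdaptedSample

/-! ### The expected prediction error of ridge regression at a fresh point -/

/-- A bound on the squared error at the fresh point `y` of ridge regression with regularizer `A`,
true parameter `θ` and training sample `Y` with noise `ε`. It is an explicit function of the data
in which only the Gram matrix of the training points *together with* `y` occurs. -/
noncomputable def freshErrorBound {ι : Type*} [Fintype ι] [DecidableEq ι] (A : Matrix ι ι ℝ)
    (θ : ι → ℝ) {q : ℕ} (Y : Fin q → ι → ℝ) (ε : Fin q → ℝ) (y : ι → ℝ) : ℝ :=
  4 * (∑ s, ε s * (Y s ⬝ᵥ (regGram A (Fin.snoc Y y : Fin (q + 1) → ι → ℝ))⁻¹.mulVec y)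
      - y ⬝ᵥ (regGram A (Fin.snoc Y y : Fin (q + 1) → ι → ℝ))⁻¹.mulVec (A.mulVec θ)) ^ 2
    + 8 * leverage A (Fin.snoc Y y : Fin (q + 1) → ι → ℝ) (Fin.last q)

section FreshPoint

variable {ι : Type*} [Fintype ι] [DecidableEq ι] {A : Matrix ι ι ℝ}

lemma sum_sq_noise_coeff_le (hA : A.PosDef) {q : ℕ} (Y : Fin q → ι → ℝ) (y : ι → ℝ) :
    ∑ s, (Y s ⬝ᵥ (regGram A (Fin.snoc Y y : Fin (q + 1) → ι → ℝ))⁻¹.mulVec y) ^ 2 ≤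
      leverage A (Fin.snoc Y y : Fin (q + 1) → ι → ℝ) (Fin.last q) := by
  have h := sum_sq_dotProduct_inv_mulVec_le hA (Fin.snoc Y y : Fin (q + 1) → ι → ℝ) (Fin.last q)
  rw [Fin.sum_univ_castSucc] at h
  simp only [Fin.snoc_castSucc, Fin.snoc_last] at h
  exact (le_add_of_nonneg_right (sq_nonneg _)).trans h

lemma sq_bias_last_le (hA : A.PosDef) {q : ℕ} (Y : Fin q → ι → ℝ) (y θ : ι → ℝ) :
    (y ⬝ᵥ (regGram A (Fin.snoc Y y : Fin (q + 1) → ι → ℝ))⁻¹.mulVec (A.mulVec θ)) ^ 2 ≤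
      θ ⬝ᵥ A.mulVec θ := by
  have h := sum_sq_dotProduct_bias_le hA (Fin.snoc Y y : Fin (q + 1) → ι → ℝ) θ
  rw [Fin.sum_univ_castSucc] at h
  simp only [Fin.snoc_castSucc, Fin.snoc_last] at h
  exact (le_add_of_nonneg_left (Finset.sum_nonneg fun _ _ => sq_nonneg _)).trans h

lemma freshErrorBound_nonneg (hA : A.PosDef) (θ : ι → ℝ) {q : ℕ} (Y : Fin q → ι → ℝ)
    (ε : Fin q → ℝ) (y : ι → ℝ) : 0 ≤ freshErrorBound A θ Y ε y := by
  have := leverage_nonneg hA (Fin.snoc Y y : Fin (q + 1) → ι → ℝ) (Fin.last q)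
  unfold freshErrorBound
  positivity

/-- At a fresh point of leverage `h ≤ 1/2` the error is at most twice the damped error of
`one_sub_leverage_mul_error`; at one of leverage `h > 1/2`, the a priori bound `4` on the squared
error is less than `8 h`. -/
lemma sq_error_le_freshErrorBound (hA : A.PosDef) {q : ℕ} (Y : Fin q → ι → ℝ) (ε : Fin q → ℝ)
    (y θ θ' : ι → ℝ)
    (hθ' : ∀ v, ∑ s, (θ' ⬝ᵥ Y s - (θ ⬝ᵥ Y s + ε s)) * (Y s ⬝ᵥ v) + v ⬝ᵥ A.mulVec θ' = 0)
    (hb : |(θ' - θ) ⬝ᵥ y| ≤ 2) :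
    ((θ' - θ) ⬝ᵥ y) ^ 2 ≤ freshErrorBound A θ Y ε y := by
  have key := one_sub_leverage_mul_error hA (Fin.snoc Y y : Fin (q + 1) → ι → ℝ) (Fin.last q)
    (Fin.castSucc) (fun f => Fin.sum_univ_castSucc f) θ θ' ε (by simpa using hθ')
  simp only [Fin.snoc_castSucc, Fin.snoc_last] at key
  unfold freshErrorBound
  rw [← key]
  set h := leverage A (Fin.snoc Y y : Fin (q + 1) → ι → ℝ) (Fin.last q) with hh
  have h0 : 0 ≤ h := leverage_nonneg hA _ _
  set D := (θ' - θ) ⬝ᵥ y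
  have hD : D ^ 2 ≤ 4 := by
    have := sq_le_sq' (by linarith [neg_abs_le D]) ((le_abs_self D).trans hb)
    linarith
  rcases le_total h (1 / 2) with h1 | h1
  · have h2 : 1 ≤ 4 * (1 - h) ^ 2 := by nlinarith
    have h3 : D ^ 2 * 1 ≤ D ^ 2 * (4 * (1 - h) ^ 2) := by gcongr
    nlinarith
  · nlinarith [sq_nonneg ((1 - h) * D)]

lemma freshErrorBound_le (A : Matrix ι ι ℝ) (θ : ι → ℝ) {q : ℕ} (Y : Fin q → ι → ℝ)
    (ε : Fin q → ℝ) (y : ι → ℝ) :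
    freshErrorBound A θ Y ε y ≤
      8 * (∑ s, ε s * (Y s ⬝ᵥ (regGram A (Fin.snoc Y y : Fin (q + 1) → ι → ℝ))⁻¹.mulVec y)) ^ 2
      + 8 * (y ⬝ᵥ (regGram A (Fin.snoc Y y : Fin (q + 1) → ι → ℝ))⁻¹.mulVec (A.mulVec θ)) ^ 2
      + 8 * leverage A (Fin.snoc Y y : Fin (q + 1) → ι → ℝ) (Fin.last q) := by
  unfold freshErrorBound
  nlinarith [sq_nonneg
    (∑ s, ε s * (Y s ⬝ᵥ (regGram A (Fin.snoc Y y : Fin (q + 1) → ι → ℝ))⁻¹.mulVec y)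
      + y ⬝ᵥ (regGram A (Fin.snoc Y y : Fin (q + 1) → ι → ℝ))⁻¹.mulVec (A.mulVec θ))]

lemma sq_sum_noise_le (hA : A.PosDef) {q : ℕ} (Y : Fin q → ι → ℝ) (ε : Fin q → ℝ) (y : ι → ℝ)
    {b : ℝ} (hε : ∀ s, |ε s| ≤ b) :
    (∑ s, ε s * (Y s ⬝ᵥ (regGram A (Fin.snoc Y y : Fin (q + 1) → ι → ℝ))⁻¹.mulVec y)) ^ 2 ≤
      q * b ^ 2 := by
  refine (Finset.sum_mul_sq_le_sq_mul_sq _ _ _).trans ?_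
  have h1 : ∑ s, ε s ^ 2 ≤ q * b ^ 2 := by
    refine (Finset.sum_le_card_nsmul _ _ (b ^ 2) fun s _ => ?_).trans (by simp)
    exact sq_le_sq' (by linarith [neg_abs_le (ε s), hε s]) ((le_abs_self _).trans (hε s))
  have h2 := (sum_sq_noise_coeff_le hA Y y).trans (leverage_le_one hA _ _)
  calc _ ≤ (q * b ^ 2) * 1 := by gcongr
    _ = _ := mul_one _

lemma abs_noise_coeff_le_one (hA : A.PosDef) {q : ℕ} (Y : Fin q → ι → ℝ) (y : ι → ℝ) (s : Fin q) :
    |Y s ⬝ᵥ (regGram A (Fin.snoc Y y : Fin (q + 1) → ι → ℝ))⁻¹.mulVec y| ≤ 1 := by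
  have h2 := (sum_sq_noise_coeff_le hA Y y).trans (leverage_le_one hA _ _)
  have h3 := (Finset.single_le_sum
    (f := fun s => (Y s ⬝ᵥ (regGram A (Fin.snoc Y y : Fin (q + 1) → ι → ℝ))⁻¹.mulVec y) ^ 2)
    (fun _ _ => sq_nonneg _) (Finset.mem_univ s)).trans h2
  exact (sq_le_one_iff_abs_le_one _).1 h3

lemma measurable_noise_coeff (A : Matrix ι ι ℝ) {α : Type*} [MeasurableSpace α] {q : ℕ}
    {Y : α → Fin q → ι → ℝ} {y : α → ι → ℝ} (hY : Measurable Y) (hy : Measurable y) (s : Fin q) :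
    Measurable fun a =>
      Y a s ⬝ᵥ (regGram A (Fin.snoc (Y a) (y a) : Fin (q + 1) → ι → ℝ))⁻¹.mulVec (y a) :=
  measurable_dotProduct_regGram_inv_mulVec A (measurable_snoc.comp (hY.prodMk hy))
    ((measurable_pi_apply s).comp hY) hy

lemma measurable_bias_last (A : Matrix ι ι ℝ) (θ : ι → ℝ) {α : Type*} [MeasurableSpace α] {q : ℕ}
    {Y : α → Fin q → ι → ℝ} {y : α → ι → ℝ} (hY : Measurable Y) (hy : Measurable y) :
    Measurable fun a => y a ⬝ᵥ
      (regGram A (Fin.snoc (Y a) (y a) : Fin (q + 1) → ι → ℝ))⁻¹.mulVec (A.mulVec θ) :=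
  measurable_dotProduct_regGram_inv_mulVec A (measurable_snoc.comp (hY.prodMk hy)) hy
    measurable_const

lemma measurable_leverage_last (A : Matrix ι ι ℝ) {α : Type*} [MeasurableSpace α] {q : ℕ}
    {Y : α → Fin q → ι → ℝ} {y : α → ι → ℝ} (hY : Measurable Y) (hy : Measurable y) :
    Measurable fun a =>
      leverage A (Fin.snoc (Y a) (y a) : Fin (q + 1) → ι → ℝ) (Fin.last q) := by
  simp only [leverage, Fin.snoc_last]
  exact measurable_dotProduct_regGram_inv_mulVec A (measurable_snoc.comp (hY.prodMk hy)) hy hy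

lemma measurable_freshErrorBound (A : Matrix ι ι ℝ) (θ : ι → ℝ) {α : Type*} [MeasurableSpace α]
    {q : ℕ} {Y : α → Fin q → ι → ℝ} {ε : α → Fin q → ℝ} {y : α → ι → ℝ} (hY : Measurable Y)
    (hε : Measurable ε) (hy : Measurable y) :
    Measurable fun a => freshErrorBound A θ (Y a) (ε a) (y a) :=
  ((((Finset.measurable_sum _ fun s _ => ((measurable_pi_apply s).comp hε).mul
    (measurable_noise_coeff A hY hy s)).sub (measurable_bias_last A θ hY hy)).pow_const 2).const_mul
      4).add ((measurable_leverage_last A hY hy).const_mul 8)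

end FreshPoint

namespace IsAdaptedSample

variable {Ω ι : Type*} {m m0 : MeasurableSpace Ω} [Fintype ι] [DecidableEq ι] {A : Matrix ι ι ℝ}
  {μ : Measure Ω} {ν : Measure (ι → ℝ)} {b : ℝ}
  {𝓕 : ℕ → MeasurableSpace Ω} {Y : ℕ → Ω → ι → ℝ} {ε : ℕ → Ω → ℝ}

lemma ae_norm_freshErrorBound_le (h : IsAdaptedSample μ ν b 𝓕 Y ε) (hA : A.PosDef) (θ : ι → ℝ)
    (q : ℕ) : ∀ᵐ ω ∂μ, ∀ y, ‖freshErrorBound A θ (fun i : Fin q => Y i ω) (fun i => ε i ω) y‖ ≤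
      8 * (q * b ^ 2) + 8 * (θ ⬝ᵥ A.mulVec θ) + 8 * 1 := by
  filter_upwards [h.ae_forall_noise_le] with ω hω y
  rw [Real.norm_of_nonneg (freshErrorBound_nonneg hA _ _ _ _)]
  refine (freshErrorBound_le A _ _ _ _).trans ?_
  gcongr
  · exact sq_sum_noise_le hA _ _ _ fun s => hω s
  · exact sq_bias_last_le hA _ _ _
  · exact leverage_le_one hA _ _

variable [IsProbabilityMeasure μ] [IsProbabilityMeasure ν]

lemma integrable_prod_sq_noise (h : IsAdaptedSample μ ν b 𝓕 Y ε) (hA : A.PosDef) (q : ℕ) :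
    Integrable (fun z : Ω × (ι → ℝ) => (∑ s : Fin q, ε s z.1 * (Y s z.1 ⬝ᵥ (regGram A
      (Fin.snoc (fun i : Fin q => Y i z.1) z.2 : Fin (q + 1) → ι → ℝ))⁻¹.mulVec z.2)) ^ 2)
      (μ.prod ν) := by
  have hYm : Measurable fun z : Ω × (ι → ℝ) => fun i : Fin q => Y i z.1 :=
    (h.measurable_features' q).comp measurable_fst
  have hεm : Measurable fun z : Ω × (ι → ℝ) => fun i : Fin q => ε i z.1 :=
    (h.measurable_noises' q).comp measurable_fst
  refine Integrable.of_bound (C := q * b ^ 2) ?_ ?_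
  · exact ((Finset.measurable_sum _ fun s _ => ((measurable_pi_apply s).comp hεm).mul
      (measurable_noise_coeff A hYm measurable_snd s)).pow_const 2).aestronglyMeasurable
  · have := Measure.quasiMeasurePreserving_fst (μ := μ) (ν := ν) |>.ae h.ae_forall_noise_le
    filter_upwards [this] with z hz
    rw [norm_pow, Real.norm_eq_abs, sq_abs]
    exact sq_sum_noise_le hA _ _ _ fun s => hz s

/-- The expected noise part of the error at an independent fresh point. -/
lemma integral_prod_sq_noise_le (h : IsAdaptedSample μ ν b 𝓕 Y ε) (hA : A.PosDef) (q : ℕ) :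
    ∫ z : Ω × (ι → ℝ), (∑ s : Fin q, ε s z.1 * (Y s z.1 ⬝ᵥ (regGram A
      (Fin.snoc (fun i : Fin q => Y i z.1) z.2 : Fin (q + 1) → ι → ℝ))⁻¹.mulVec z.2)) ^ 2
      ∂μ.prod ν ≤ b ^ 2 * (Fintype.card ι / (q + 1)) := by
  have hint := h.integrable_prod_sq_noise hA q
  have hlint : Integrable (fun z : (Fin q → ι → ℝ) × (ι → ℝ) =>
      leverage A (Fin.snoc z.1 z.2 : Fin (q + 1) → ι → ℝ) (Fin.last q))
      ((Measure.pi fun _ : Fin q => ν).prod ν) :=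
    Integrable.of_bound (measurable_leverage_last A measurable_fst
      measurable_snd).aestronglyMeasurable 1 <| Filter.Eventually.of_forall fun z => by
        rw [Real.norm_of_nonneg (leverage_nonneg hA _ _)]
        exact leverage_le_one hA _ _
  have hcint : Integrable (fun z : (Fin q → ι → ℝ) × (ι → ℝ) => ∑ s, (z.1 s ⬝ᵥ (regGram A
      (Fin.snoc z.1 z.2 : Fin (q + 1) → ι → ℝ))⁻¹.mulVec z.2) ^ 2)
      ((Measure.pi fun _ : Fin q => ν).prod ν) := by
    refine hlint.mono' (Finset.measurable_sum _ fun s _ => (measurable_noise_coeff A measurable_fst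
      measurable_snd s).pow_const 2).aestronglyMeasurable <| Filter.Eventually.of_forall fun z => ?_
    rw [Real.norm_of_nonneg (Finset.sum_nonneg fun _ _ => sq_nonneg _)]
    exact sum_sq_noise_coeff_le hA _ _
  rw [integral_prod_symm _ hint]
  calc _ ≤ ∫ y, b ^ 2 * ∫ z : Fin q → ι → ℝ, ∑ s, (z s ⬝ᵥ (regGram A
          (Fin.snoc z y : Fin (q + 1) → ι → ℝ))⁻¹.mulVec y) ^ 2
          ∂(Measure.pi fun _ : Fin q => ν) ∂ν := by
        refine integral_mono hint.integral_prod_right (hcint.integral_prod_right.const_mul _)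
          fun y => ?_
        exact h.integral_sq_sum_noise_le (fun s z => z s ⬝ᵥ (regGram A
          (Fin.snoc z y : Fin (q + 1) → ι → ℝ))⁻¹.mulVec y)
          (fun s => measurable_noise_coeff A measurable_id measurable_const s)
          (fun s z => abs_noise_coeff_le_one hA z y s)
    _ = b ^ 2 * ∫ z : (Fin q → ι → ℝ) × (ι → ℝ), ∑ s, (z.1 s ⬝ᵥ (regGram A
          (Fin.snoc z.1 z.2 : Fin (q + 1) → ι → ℝ))⁻¹.mulVec z.2) ^ 2
          ∂(Measure.pi fun _ : Fin q => ν).prod ν := by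
        rw [integral_const_mul, integral_prod_symm _ hcint]
    _ ≤ _ := by
        gcongr
        refine (integral_mono hcint hlint fun z => ?_).trans (integral_leverage_snoc_le hA ν q)
        exact sum_sq_noise_coeff_le hA _ _

/-- The expected squared error at a fresh point is of order dimension over sample size, without
logarithmic factors. -/
lemma integral_prod_freshErrorBound_le (h : IsAdaptedSample μ ν b 𝓕 Y ε) (hA : A.PosDef)
    (θ : ι → ℝ) (q : ℕ) :
    ∫ z : Ω × (ι → ℝ), freshErrorBound A θ (fun i : Fin q => Y i z.1) (fun i => ε i z.1) z.2
      ∂μ.prod ν ≤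
      (8 * (b ^ 2 + 1) * Fintype.card ι + 8 * (θ ⬝ᵥ A.mulVec θ)) / (q + 1) := by
  have hYm : Measurable fun z : Ω × (ι → ℝ) => fun i : Fin q => Y i z.1 :=
    (h.measurable_features' q).comp measurable_fst
  have hεm : Measurable fun z : Ω × (ι → ℝ) => fun i : Fin q => ε i z.1 :=
    (h.measurable_noises' q).comp measurable_fst
  have i1 := h.integrable_prod_sq_noise hA q
  have i2 : Integrable (fun z : Ω × (ι → ℝ) => (z.2 ⬝ᵥ (regGram A
      (Fin.snoc (fun i : Fin q => Y i z.1) z.2 : Fin (q + 1) → ι → ℝ))⁻¹.mulVec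
        (A.mulVec θ)) ^ 2) (μ.prod ν) := by
    refine Integrable.of_bound (C := θ ⬝ᵥ A.mulVec θ)
      ((measurable_bias_last A θ hYm measurable_snd).pow_const 2).aestronglyMeasurable <|
      Filter.Eventually.of_forall fun z => ?_
    rw [norm_pow, Real.norm_eq_abs, sq_abs]
    exact sq_bias_last_le hA _ _ _
  have i3 : Integrable (fun z : Ω × (ι → ℝ) => leverage A
      (Fin.snoc (fun i : Fin q => Y i z.1) z.2 : Fin (q + 1) → ι → ℝ) (Fin.last q))
      (μ.prod ν) := by
    refine Integrable.of_bound (C := 1)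
      (measurable_leverage_last A hYm measurable_snd).aestronglyMeasurable <|
      Filter.Eventually.of_forall fun z => ?_
    rw [Real.norm_of_nonneg (leverage_nonneg hA _ _)]
    exact leverage_le_one hA _ _
  have i0 : Integrable (fun z : Ω × (ι → ℝ) =>
      freshErrorBound A θ (fun i : Fin q => Y i z.1) (fun i => ε i z.1) z.2) (μ.prod ν) := by
    refine Integrable.of_bound
      (measurable_freshErrorBound A θ hYm hεm measurable_snd).aestronglyMeasurable
      (8 * (q * b ^ 2) + 8 * (θ ⬝ᵥ A.mulVec θ) + 8 * 1) ?_
    have := Measure.quasiMeasurePreserving_fst (μ := μ) (ν := ν) |>.ae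
      (h.ae_norm_freshErrorBound_le hA θ q)
    filter_upwards [this] with z hz using hz z.2
  have hpair : AEMeasurable (fun z : Ω × (ι → ℝ) => ((fun i : Fin q => Y i z.1), z.2))
      (μ.prod ν) := (hYm.prodMk measurable_snd).aemeasurable
  have b2 : ∫ z : Ω × (ι → ℝ), (z.2 ⬝ᵥ (regGram A
      (Fin.snoc (fun i : Fin q => Y i z.1) z.2 : Fin (q + 1) → ι → ℝ))⁻¹.mulVec
        (A.mulVec θ)) ^ 2 ∂μ.prod ν ≤ (θ ⬝ᵥ A.mulVec θ) / (q + 1) := by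
    refine le_trans (le_of_eq ?_) (integral_sq_bias_snoc_le hA ν q θ)
    rw [← h.map_features_prod q, integral_map hpair
      ((measurable_bias_last A θ measurable_fst measurable_snd).pow_const 2).aestronglyMeasurable]
  have b3 : ∫ z : Ω × (ι → ℝ), leverage A
      (Fin.snoc (fun i : Fin q => Y i z.1) z.2 : Fin (q + 1) → ι → ℝ) (Fin.last q) ∂μ.prod ν ≤
      Fintype.card ι / (q + 1) := by
    refine le_trans (le_of_eq ?_) (integral_leverage_snoc_le hA ν q)
    rw [← h.map_features_prod q, integral_map hpair
      (measurable_leverage_last A measurable_fst measurable_snd).aestronglyMeasurable]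
  have b1 := h.integral_prod_sq_noise_le hA q
  refine (integral_mono i0 (((i1.const_mul 8).add (i2.const_mul 8)).add (i3.const_mul 8))
    fun z => freshErrorBound_le A _ _ _ _).trans ?_
  have e := integral_add ((i1.const_mul 8).add (i2.const_mul 8)) (i3.const_mul 8)
  have e' := integral_add (i1.const_mul 8) (i2.const_mul 8)
  simp only [Pi.add_apply, integral_const_mul] at e e' ⊢
  rw [e, e']
  have : (8 * (b ^ 2 + 1) * Fintype.card ι + 8 * (θ ⬝ᵥ A.mulVec θ)) / ((q : ℝ) + 1) =
      8 * (b ^ 2 * (Fintype.card ι / (q + 1))) + 8 * ((θ ⬝ᵥ A.mulVec θ) / (q + 1))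
        + 8 * (Fintype.card ι / (q + 1)) := by ring
  rw [this]
  gcongr

/-- The expected squared errors at the members of a fresh random tuple `V`, independent of the
training sample, if a uniformly chosen member has the law `ν` of the training points. -/
lemma integral_sum_freshErrorBound_le (h : IsAdaptedSample μ ν b 𝓕 Y ε) (hA : A.PosDef)
    (θ : ι → ℝ) (q : ℕ) (hm : m ≤ m0)
    (hY : ∀ i < q, Measurable[m] (Y i)) (hε : ∀ i < q, Measurable[m] (ε i))
    {K : ℕ} (hK : 0 < K) (V : Fin K → Ω → ι → ℝ) (hV : ∀ j, Measurable (V j))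
    (hind : ∀ j, Indep m (MeasurableSpace.comap (V j) inferInstance) μ)
    (hlaw : (K : ENNReal)⁻¹ • ∑ j, μ.map (V j) = ν) :
    (∀ j, Integrable (fun ω => freshErrorBound A θ (fun i : Fin q => Y i ω) (fun i => ε i ω)
      (V j ω)) μ) ∧
    ∫ ω, ∑ j, freshErrorBound A θ (fun i : Fin q => Y i ω) (fun i => ε i ω) (V j ω) ∂μ ≤
      K * ((8 * (b ^ 2 + 1) * Fintype.card ι + 8 * (θ ⬝ᵥ A.mulVec θ)) / (q + 1)) := by
  set X : Ω → (Fin q → ι → ℝ) × (Fin q → ℝ) :=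
    fun ω => ((fun i : Fin q => Y i ω), fun i => ε i ω) with hXdef
  have hX : Measurable[m] X := by
    have h1 : Measurable[m] fun ω (i : Fin q) => Y i ω :=
      @measurable_pi_lambda _ _ _ m _ _ fun i => hY i i.2
    have h2 : Measurable[m] fun ω (i : Fin q) => ε i ω :=
      @measurable_pi_lambda _ _ _ m _ _ fun i => hε i i.2
    exact h1.prodMk h2
  have hX' : Measurable X := hX.mono hm le_rfl
  have hmap : ∀ j, μ.map (fun ω => (X ω, V j ω)) = (μ.map X).prod (μ.map (V j)) := fun j =>
    (hind j).map_prodMk hm hX (hV j)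
  have hΨ : Measurable fun z : ((Fin q → ι → ℝ) × (Fin q → ℝ)) × (ι → ℝ) =>
      freshErrorBound A θ z.1.1 z.1.2 z.2 :=
    measurable_freshErrorBound A θ (measurable_fst.comp measurable_fst)
      (measurable_snd.comp measurable_fst) measurable_snd
  have hint : ∀ j, Integrable (fun ω => freshErrorBound A θ (fun i : Fin q => Y i ω)
      (fun i => ε i ω) (V j ω)) μ := fun j => by
    refine Integrable.of_bound (hΨ.comp (hX'.prodMk (hV j))).aestronglyMeasurable
      (8 * (q * b ^ 2) + 8 * (θ ⬝ᵥ A.mulVec θ) + 8 * 1) ?_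
    filter_upwards [h.ae_norm_freshErrorBound_le hA θ q] with ω hω using hω _
  refine ⟨hint, ?_⟩
  have hprob : IsProbabilityMeasure (μ.map X) := Measure.isProbabilityMeasure_map hX'.aemeasurable
  have hprod : (μ.map X).prod ν = (K : ENNReal)⁻¹ • ∑ j, (μ.map X).prod (μ.map (V j)) := by
    refine Measure.prod_eq fun s t _ _ => ?_
    have : ∀ j, IsProbabilityMeasure (μ.map (V j)) := fun j =>
      Measure.isProbabilityMeasure_map (hV j).aemeasurable
    rw [← hlaw]
    simp only [Measure.smul_apply, Measure.finsetSum_apply, Measure.prod_prod, smul_eq_mul,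
      ← Finset.mul_sum]
    ring
  have hmain := h.integral_prod_freshErrorBound_le hA θ q
  have e1 : ∫ z : Ω × (ι → ℝ), freshErrorBound A θ (fun i : Fin q => Y i z.1)
      (fun i => ε i z.1) z.2 ∂μ.prod ν =
      ∫ z, freshErrorBound A θ z.1.1 z.1.2 z.2 ∂(μ.map X).prod ν := by
    have h2 : (μ.map X).prod ν = (μ.prod ν).map (fun z => (X z.1, z.2)) := by
      conv_lhs => rw [← Measure.map_id (μ := ν)]
      rw [Measure.map_prod_map _ _ hX' measurable_id]
      rfl
    rw [h2]
    exact (integral_map (φ := fun z : Ω × (ι → ℝ) => (X z.1, z.2))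
      ((hX'.comp measurable_fst).prodMk measurable_snd).aemeasurable
      hΨ.aestronglyMeasurable).symm
  have e2 : ∀ j, ∫ z, freshErrorBound A θ z.1.1 z.1.2 z.2 ∂(μ.map X).prod (μ.map (V j)) =
      ∫ ω, freshErrorBound A θ (fun i : Fin q => Y i ω) (fun i => ε i ω) (V j ω) ∂μ := fun j => by
    rw [← hmap j, integral_map (hX'.prodMk (hV j)).aemeasurable hΨ.aestronglyMeasurable]
  rw [e1, hprod, integral_smul_measure, integral_finsetSum_measure] at hmain
  · simp only [e2, ENNReal.toReal_inv, ENNReal.toReal_natCast, smul_eq_mul] at hmain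
    rw [integral_finsetSum _ fun j _ => hint j]
    rwa [inv_mul_le_iff₀ (by exact_mod_cast hK)] at hmain
  · intro j _
    rw [← hmap j, integrable_map_measure hΨ.aestronglyMeasurable (hX'.prodMk (hV j)).aemeasurable]
    exact hint j

end IsAdaptedSample

/-! ### Exploration rounds as an adapted i.i.d. sample -/

/-- The feature vector in `ℝ^{dn}` of an item with features `v` shown to user `i`: the block of user
`i` is `v`, the other blocks vanish. -/
noncomputable def userFeature {n d : ℕ} (i : Fin n) (v : EuclideanSpace ℝ (Fin d)) :
    Fin n × Fin d → ℝ :=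
  fun p => if p.1 = i then v p.2 else 0

lemma stack_dotProduct_userFeature {n d : ℕ} (w : Fin n → EuclideanSpace ℝ (Fin d)) (i : Fin n)
    (v : EuclideanSpace ℝ (Fin d)) : stack w ⬝ᵥ userFeature i v = inner ℝ (w i) v := by
  simp only [dotProduct, stack, userFeature, Fintype.sum_prod_type, mul_ite, mul_zero,
    PiLp.inner_apply, RCLike.inner_apply, conj_trivial]
  rw [Finset.sum_eq_single i (fun j _ hj => by simp [hj]) (by simp)]
  simp [mul_comm]

lemma measurable_userFeature {n d : ℕ} :
    Measurable fun p : Fin n × EuclideanSpace ℝ (Fin d) => userFeature p.1 p.2 := by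
  refine measurable_from_prod_countable_right fun i => ?_
  refine measurable_pi_iff.2 fun p => ?_
  by_cases h : p.1 = i
  · simp only [userFeature, h, if_true]
    exact (EuclideanSpace.proj p.2 : EuclideanSpace ℝ (Fin d) →L[ℝ] ℝ).continuous.measurable
  · simp only [userFeature, h, if_false]
    exact measurable_const

lemma measurable_userFeature_apply {n d K : ℕ} (j : Fin K) :
    Measurable fun p : Fin n × (Fin K → EuclideanSpace ℝ (Fin d)) => userFeature p.1 (p.2 j) :=
  measurable_userFeature.comp (measurable_fst.prodMk ((measurable_pi_apply j).comp measurable_snd))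

lemma measurable_eval_index {K : ℕ} {E : Type*} [MeasurableSpace E] :
    Measurable fun p : (Fin K → E) × Fin K => p.1 p.2 :=
  measurable_from_prod_countable_left fun j => measurable_pi_apply j

lemma strictMono_epochStart {n : ℕ} (L : Matrix (Fin n) (Fin n) ℝ) (lam δ : ℝ) :
    StrictMono (epochStart L lam δ) := by
  refine strictMono_nat_of_lt_succ fun q => ?_
  rw [epochStart, epochStart, Finset.sum_range_succ]
  omega

section Model

variable {Ω : Type*} {m0 : MeasurableSpace Ω} {n d K : ℕ}
  {wstar : Fin n → EuclideanSpace ℝ (Fin d)} {user : ℕ → Ω → Fin n}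
  {x : ℕ → Ω → Fin K → EuclideanSpace ℝ (Fin d)} {η : ℕ → Ω → Fin K → ℝ}
  {item : ℕ → Ω → Fin K} {west : ℕ → Ω → Fin n → EuclideanSpace ℝ (Fin d)}
  {μ : Measure Ω} {σ lam δ : ℝ} {L : Matrix (Fin n) (Fin n) ℝ}

lemma measurable_inner_eval (w : Fin n → EuclideanSpace ℝ (Fin d)) :
    Measurable fun p : Fin n × (Fin K → EuclideanSpace ℝ (Fin d)) × Fin K =>
      (inner ℝ (w p.1) (p.2.1 p.2.2) : ℝ) :=
  ((measurable_of_countable w).comp measurable_fst).inner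
    (measurable_eval_index.comp measurable_snd)

/-- The feature vector in `ℝ^{dn}` of the item recommended in round `t`. -/
noncomputable def chosenFeature (user : ℕ → Ω → Fin n)
    (x : ℕ → Ω → Fin K → EuclideanSpace ℝ (Fin d)) (item : ℕ → Ω → Fin K) (t : ℕ) (ω : Ω) :
    Fin n × Fin d → ℝ :=
  userFeature (user t ω) (x t ω (item t ω))

lemma measurable_observation_history {τ t : ℕ} (h : τ < t) :
    Measurable[history wstar user x η item t] (observation wstar user x η item τ) :=
  measurable_iff_comap_le.2 (le_iSup₂_of_le τ h le_rfl)

lemma measurable_chosenFeature_history {τ t : ℕ} (h : τ < t) :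
    Measurable[history wstar user x η item t] (chosenFeature user x item τ) := by
  have h1 : Measurable fun o : Fin n × (Fin K → EuclideanSpace ℝ (Fin d)) × Fin K × ℝ =>
      userFeature o.1 (o.2.1 o.2.2.1) :=
    measurable_userFeature.comp (measurable_fst.prodMk (measurable_eval_index.comp
      ((measurable_fst.comp measurable_snd).prodMk
        (measurable_fst.comp (measurable_snd.comp measurable_snd)))))
  exact h1.comp (measurable_observation_history (wstar := wstar) (η := η) h)

/-- The noise in the rating of the recommended item is determined by the observation of the round,
as the difference of the observed rating and the expected one. -/
lemma measurable_chosenNoise_history {τ t : ℕ} (h : τ < t) :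
    Measurable[history wstar user x η item t] (fun ω => η τ ω (item τ ω)) := by
  have h1 : Measurable fun o : Fin n × (Fin K → EuclideanSpace ℝ (Fin d)) × Fin K × ℝ =>
      o.2.2.2 - (inner ℝ (wstar o.1) (o.2.1 o.2.2.1) : ℝ) :=
    (measurable_snd.comp (measurable_snd.comp measurable_snd)).sub
      ((measurable_inner_eval wstar).comp (measurable_fst.prodMk
        ((measurable_fst.comp measurable_snd).prodMk
          (measurable_fst.comp (measurable_snd.comp measurable_snd)))))
  have h2 := h1.comp (measurable_observation_history (wstar := wstar) (user := user) (x := x)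
    (η := η) (item := item) h)
  convert h2 using 1
  ext ω
  simp [observation, rating]

lemma history_mono : Monotone (history wstar user x η item) := fun _ _ hst =>
  iSup₂_le fun τ hτ => le_iSup₂_of_le τ (hτ.trans_le hst) le_rfl

lemma context_le (hB : IsGangOfBandits μ σ wstar user x η item) (t : ℕ) :
    context user x t ≤ m0 :=
  ((hB.measurable_user t).prodMk (hB.measurable_features t)).comap_le

lemma history_le (hB : IsGangOfBandits μ σ wstar user x η item)
    (hi : ∀ t, Measurable (item t)) (t : ℕ) : history wstar user x η item t ≤ m0 := by
  refine iSup₂_le fun τ _ => Measurable.comap_le ?_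
  have h1 := hB.measurable_user τ
  have h2 := hB.measurable_features τ
  have h3 : Measurable fun ω => η τ ω (item τ ω) :=
    measurable_eval_index.comp ((hB.measurable_noise τ).prodMk (hi τ))
  have h4 : Measurable fun ω => rating wstar user x η τ ω (item τ ω) :=
    ((measurable_inner_eval wstar).comp (h1.prodMk (h2.prodMk (hi τ)))).add h3
  exact h1.prodMk (h2.prodMk ((hi τ).prodMk h4))

lemma measurable_contextFeature (t : ℕ) (j : Fin K) :
    Measurable[context user x t] (fun ω => userFeature (user t ω) (x t ω j)) := by
  exact (measurable_userFeature_apply j).comp (comap_measurable fun ω => (user t ω, x t ω))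

lemma map_contextFeature (hB : IsGangOfBandits μ σ wstar user x η item) (t : ℕ) (j : Fin K) :
    μ.map (fun ω => userFeature (user t ω) (x t ω j)) =
      μ.map (fun ω => userFeature (user 0 ω) (x 0 ω j)) := by
  exact ((hB.identDistrib t).comp (measurable_userFeature_apply j)).map_eq

/-- The law of the feature vector in `ℝ^{dn}` of a uniformly chosen item of the first round, which
is the law of the recommended one in every exploration round. -/
noncomputable def exploreLaw (μ : Measure Ω) (user : ℕ → Ω → Fin n)
    (x : ℕ → Ω → Fin K → EuclideanSpace ℝ (Fin d)) : Measure (Fin n × Fin d → ℝ) :=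
  (K : ENNReal)⁻¹ • ∑ j, μ.map (fun ω => userFeature (user 0 ω) (x 0 ω j))

lemma isProbabilityMeasure_exploreLaw [IsProbabilityMeasure μ]
    (hB : IsGangOfBandits μ σ wstar user x η item) (hK : 0 < K) :
    IsProbabilityMeasure (exploreLaw μ user x) := by
  have h : ∀ j, IsProbabilityMeasure (μ.map (fun ω => userFeature (user 0 ω) (x 0 ω j))) :=
    fun j => Measure.isProbabilityMeasure_map
      ((measurable_contextFeature 0 j).mono (context_le hB 0) le_rfl).aemeasurable
  constructor
  simp only [exploreLaw, Measure.smul_apply, Measure.finsetSum_apply, measure_univ, smul_eq_mul,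
    Finset.sum_const, Finset.card_univ, Fintype.card_fin, nsmul_eq_mul, mul_one]
  exact ENNReal.inv_mul_cancel (by exact_mod_cast hK.ne') (ENNReal.natCast_ne_top K)

lemma abs_inner_wstar_le {i : Fin n} {v : EuclideanSpace ℝ (Fin d)} (hw : ‖wstar i‖ ≤ 1)
    (hv : ‖v‖ ≤ 1) : |(inner ℝ (wstar i) v : ℝ)| ≤ 1 := by
  refine (abs_real_inner_le_norm _ _).trans ?_
  nlinarith [norm_nonneg (wstar i), norm_nonneg v]

lemma ae_abs_noise_le (hB : IsGangOfBandits μ σ wstar user x η item) (t : ℕ) :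
    ∀ᵐ ω ∂μ, ∀ j, |η t ω j| ≤ 2 := by
  filter_upwards [hB.norm_features_le t, hB.rating_mem t] with ω h1 h2 j
  have h3 := h2 j
  have h4 := abs_le.1 (abs_inner_wstar_le (hB.norm_wstar_le (user t ω)) (h1 j))
  simp only [rating, Set.mem_Icc] at h3
  exact abs_le.2 ⟨by linarith, by linarith⟩

/-- In an exploration round, the feature vector of the recommended item has law `exploreLaw` and is
independent of the past. -/
lemma measure_inter_chosenFeature (hB : IsGangOfBandits μ σ wstar user x η item)
    (hG : IsEpochGreedy μ L lam δ wstar user x η item west) {t : ℕ}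
    (ht : IsExploration L lam δ t) {D : Set Ω}
    (hD : MeasurableSet[history wstar user x η item t] D) {B : Set (Fin n × Fin d → ℝ)}
    (hBm : MeasurableSet B) :
    μ (D ∩ chosenFeature user x item t ⁻¹' B) = μ D * exploreLaw μ user x B := by
  set V : Fin K → Ω → Fin n × Fin d → ℝ := fun j ω => userFeature (user t ω) (x t ω j) with hV
  have hVm : ∀ j, MeasurableSet[context user x t] (V j ⁻¹' B) := fun j =>
    measurable_contextFeature t j hBm
  have hset : D ∩ chosenFeature user x item t ⁻¹' B =
      ⋃ j ∈ (Finset.univ : Finset (Fin K)), item t ⁻¹' {j} ∩ (V j ⁻¹' B ∩ D) := by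
    ext ω
    simp [chosenFeature, hV, and_comm]
  have hmem : ∀ j, MeasurableSet[history wstar user x η item t ⊔ context user x t ⊔
      MeasurableSpace.comap (η t) inferInstance] (V j ⁻¹' B ∩ D) := by
    intro j
    refine MeasurableSet.inter ?_ ?_
    · exact (le_sup_right.trans le_sup_left : context user x t ≤ _) _ (hVm j)
    · exact (le_sup_left.trans le_sup_left : history wstar user x η item t ≤ _) _ hD
  have hterm : ∀ j, μ (item t ⁻¹' {j} ∩ (V j ⁻¹' B ∩ D)) =
      (K : ENNReal)⁻¹ * (μ.map (fun ω => userFeature (user 0 ω) (x 0 ω j)) B * μ D) := by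
    intro j
    rw [(Indep_iff _ _ μ).1 (hG.explore_indep t ht) _ _ ⟨{j}, measurableSet_singleton j, rfl⟩
      (hmem j), (Indep_iff _ _ μ).1 (hB.indep_history t) _ _ (hVm j) hD,
      ← map_contextFeature hB t j,
      Measure.map_apply ((measurable_contextFeature t j).mono (context_le hB t) le_rfl) hBm]
    congr 1
    exact hG.explore_uniform t ht j
  rw [hset, measure_biUnion_finset]
  · simp only [hterm, exploreLaw, Measure.smul_apply, Measure.finsetSum_apply, smul_eq_mul,
      ← Finset.mul_sum, ← Finset.sum_mul]
    ring
  · intro i _ j _ hij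
    refine Set.disjoint_left.2 fun ω h1 h2 => hij ?_
    exact h1.1.symm.trans h2.1
  · intro j _
    exact (hG.measurable_item t (measurableSet_singleton j)).inter
      ((context_le hB t _ (hVm j)).inter (history_le hB hG.measurable_item t _ hD))

/-- In an exploration round, the noise of the recommended item is centred given the past and the
feature vector of that item, although the model only makes it so given the past and the context:
the choice of the item is independent of both and of the noise. -/
lemma integral_chosenFeature_mul_noise [IsProbabilityMeasure μ]
    (hB : IsGangOfBandits μ σ wstar user x η item)
    (hG : IsEpochGreedy μ L lam δ wstar user x η item west) {t : ℕ}
    (ht : IsExploration L lam δ t) {f : Ω → (Fin n × Fin d → ℝ) → ℝ}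
    (hf : Measurable[(history wstar user x η item t).prod inferInstance] (Function.uncurry f))
    {C : ℝ} (hC : ∀ᵐ ω ∂μ, ∀ y, |f ω y| ≤ C) :
    ∫ ω, f ω (chosenFeature user x item t ω) * η t ω (item t ω) ∂μ = 0 := by
  set W : Fin K → Ω → ℝ := fun j ω => f ω (userFeature (user t ω) (x t ω j)) with hW
  have hHle : history wstar user x η item t ≤ m0 := history_le hB hG.measurable_item t
  have hle : history wstar user x η item t ⊔ context user x t ≤ m0 := sup_le hHle (context_le hB t)
  have hηle : MeasurableSpace.comap (η t) inferInstance ≤ m0 := (hB.measurable_noise t).comap_le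
  have hWm : ∀ j, Measurable[history wstar user x η item t ⊔ context user x t] (W j) := by
    intro j
    have h1 : @Measurable Ω (Ω × (Fin n × Fin d → ℝ))
        (history wstar user x η item t ⊔ context user x t)
        ((history wstar user x η item t).prod inferInstance)
        (fun ω => (ω, userFeature (user t ω) (x t ω j))) :=
      @Measurable.prodMk _ (history wstar user x η item t ⊔ context user x t) _ _
        (history wstar user x η item t) _ _ _
        (measurable_id'' le_sup_left)
        ((measurable_contextFeature t j).mono le_sup_right le_rfl)
    exact hf.comp h1
  have hηm : ∀ j, Measurable fun ω => η t ω j := fun j =>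
    (measurable_pi_apply j).comp (hB.measurable_noise t)
  have hηint : ∀ j, Integrable (fun ω => η t ω j) μ := fun j =>
    Integrable.of_bound (hηm j).aestronglyMeasurable 2 <| by
      filter_upwards [ae_abs_noise_le hB t] with ω hω using hω j
  have hWηint : ∀ j, Integrable (fun ω => W j ω * η t ω j) μ := fun j => by
    refine (hηint j).bdd_mul ((hWm j).mono hle le_rfl).aestronglyMeasurable (c := C) ?_
    filter_upwards [hC] with ω hω using hω _
  have hzero : ∀ j, ∫ ω, W j ω * η t ω j ∂μ = 0 := by
    intro j
    have h1 := condExp_mul_of_stronglyMeasurable_left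
      (m := history wstar user x η item t ⊔ context user x t)
      (hWm j).stronglyMeasurable (hWηint j) (hηint j)
    have h2 := hB.noise_centred t j
    have e := integral_condExp (μ := μ) hle (f := W j * fun ω => η t ω j)
    change ∫ ω, (W j * fun ω => η t ω j) ω ∂μ = 0
    rw [← e]
    refine integral_eq_zero_of_ae ?_
    filter_upwards [h1, h2] with ω h3 h4
    rw [h3, Pi.mul_apply, h4]
    simp
  have hsplit : ∀ ω, f ω (chosenFeature user x item t ω) * η t ω (item t ω) =
      ∑ j, (if item t ω = j then (1 : ℝ) else 0) * (W j ω * η t ω j) := by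
    intro ω
    simp [hW, chosenFeature]
  have hind : ∀ j, Measurable[MeasurableSpace.comap (item t) inferInstance]
      fun ω => if item t ω = j then (1 : ℝ) else 0 := fun j =>
    (measurable_of_countable fun i : Fin K => if i = j then (1 : ℝ) else 0).comp
      (comap_measurable (item t))
  have hitem : MeasurableSpace.comap (item t) inferInstance ≤ m0 :=
    (hG.measurable_item t).comap_le
  have hint : ∀ j, Integrable (fun ω => (if item t ω = j then (1 : ℝ) else 0) *
      (W j ω * η t ω j)) μ := fun j => by
    refine (hWηint j).bdd_mul ((hind j).mono hitem le_rfl).aestronglyMeasurable (c := 1) ?_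
    refine Filter.Eventually.of_forall fun ω => ?_
    split_ifs <;> simp
  simp only [hsplit]
  rw [integral_finsetSum _ fun j _ => hint j]
  refine Finset.sum_eq_zero fun j _ => ?_
  have hWη : Measurable[history wstar user x η item t ⊔ context user x t ⊔
      MeasurableSpace.comap (η t) inferInstance]
      fun ω => W j ω * η t ω j :=
    ((hWm j).mono le_sup_left le_rfl).mul
      (((measurable_pi_apply j).comp (comap_measurable (η t))).mono le_sup_right le_rfl)
  have hindep : IndepFun (fun ω => if item t ω = j then (1 : ℝ) else 0)
      (fun ω => W j ω * η t ω j) μ :=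
    indep_of_indep_of_le_left (indep_of_indep_of_le_right (hG.explore_indep t ht) hWη.comap_le)
      (hind j).comap_le
  rw [hindep.integral_fun_mul_eq_mul_integral
    ((hind j).mono hitem le_rfl).aestronglyMeasurable (hWηint j).aestronglyMeasurable, hzero j,
    mul_zero]

/-- The exploration rounds provide an i.i.d. design with adapted noise bounded by `2`. -/
lemma isAdaptedSample_exploration [IsProbabilityMeasure μ]
    (hB : IsGangOfBandits μ σ wstar user x η item)
    (hG : IsEpochGreedy μ L lam δ wstar user x η item west) :
    IsAdaptedSample μ (exploreLaw μ user x) 2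
      (fun s => history wstar user x η item (epochStart L lam δ s))
      (fun s => chosenFeature user x item (epochStart L lam δ s))
      (fun s ω => η (epochStart L lam δ s) ω (item (epochStart L lam δ s) ω)) where
  le s := history_le hB hG.measurable_item _
  mono := history_mono.comp (strictMono_epochStart L lam δ).monotone
  measurable_feature s :=
    measurable_chosenFeature_history (strictMono_epochStart L lam δ s.lt_succ_self)
  measurable_noise s :=
    measurable_chosenNoise_history (strictMono_epochStart L lam δ s.lt_succ_self)
  map_feature s := by
    have hm : Measurable (chosenFeature user x item (epochStart L lam δ s)) :=
      (measurable_chosenFeature_history (wstar := wstar) (η := η) (Nat.lt_succ_self _)).mono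
        (history_le hB hG.measurable_item _) le_rfl
    ext B hBm
    rw [Measure.map_apply hm hBm]
    simpa using measure_inter_chosenFeature hB hG ⟨s, rfl⟩ MeasurableSet.univ hBm
  indep s := by
    refine (Indep_iff _ _ μ).2 ?_
    rintro D _ hD ⟨B, hBm, rfl⟩
    rw [measure_inter_chosenFeature hB hG ⟨s, rfl⟩ hD hBm]
    congr 1
    simpa using (measure_inter_chosenFeature hB hG ⟨s, rfl⟩ MeasurableSet.univ hBm).symm
  noise_bound s := by
    filter_upwards [ae_abs_noise_le hB (epochStart L lam δ s)] with ω hω using hω _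
  noise_centred s f hf hC := by
    obtain ⟨C, hC⟩ := hC
    exact integral_chosenFeature_mul_noise hB hG ⟨s, rfl⟩ hf hC

end Model

/-! ### The regularizer and the trace of `L⁻¹` -/

section Laplacian

variable {n : ℕ}

lemma isHermitian_normalizedLaplacian (G : SimpleGraph (Fin n)) :
    (normalizedLaplacian G).IsHermitian := by
  classical
  unfold normalizedLaplacian
  have h := Matrix.isHermitian_conjTranspose_mul_mul
    (Matrix.diagonal fun i => (Real.sqrt (G.degree i))⁻¹) (G.isHermitian_lapMatrix (R := ℝ))
  simpa [Matrix.diagonal_conjTranspose] using! h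

lemma dotProduct_normalizedLaplacian_mulVec (G : SimpleGraph (Fin n)) (v : Fin n → ℝ) :
    0 ≤ v ⬝ᵥ (normalizedLaplacian G).mulVec v ∧
      v ⬝ᵥ (normalizedLaplacian G).mulVec v ≤ 2 * (v ⬝ᵥ v) := by
  classical
  set u : Fin n → ℝ := fun i => (Real.sqrt (G.degree i))⁻¹ * v i with hu
  have h1 : v ⬝ᵥ (normalizedLaplacian G).mulVec v = Matrix.toLinearMap₂' ℝ (G.lapMatrix ℝ) u u := by
    have e : (Matrix.diagonal fun i => (Real.sqrt (G.degree i))⁻¹).mulVec v = u := by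
      ext i
      simp [Matrix.mulVec_diagonal, hu]
    have e' : Matrix.vecMul v (Matrix.diagonal fun i => (Real.sqrt (G.degree i))⁻¹) = u := by
      ext i
      simp [Matrix.vecMul_diagonal, hu, mul_comm]
    rw [Matrix.toLinearMap₂'_apply', normalizedLaplacian, ← Matrix.mulVec_mulVec,
      ← Matrix.mulVec_mulVec, e, Matrix.dotProduct_mulVec, e']
  rw [h1, SimpleGraph.lapMatrix_toLinearMap₂']
  have hdeg : ∑ i, (G.degree i : ℝ) * u i ^ 2 ≤ v ⬝ᵥ v := by
    refine Finset.sum_le_sum fun i _ => ?_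
    rcases Nat.eq_zero_or_pos (G.degree i) with h | h
    · simp [h, mul_self_nonneg]
    · have h2 : (0 : ℝ) < G.degree i := by exact_mod_cast h
      simp only [hu, mul_pow, inv_pow, Real.sq_sqrt h2.le]
      rw [mul_inv_cancel_left₀ h2.ne', pow_two]
  have hrow : ∀ i, ∑ j, (if G.Adj i j then u i ^ 2 else 0) = (G.degree i : ℝ) * u i ^ 2 := by
    intro i
    rw [G.degree_eq_sum_if_adj (R := ℝ), Finset.sum_mul]
    exact Finset.sum_congr rfl fun j _ => by split_ifs <;> simp
  have hcol : ∑ i, ∑ j, (if G.Adj i j then u j ^ 2 else 0) = ∑ i, (G.degree i : ℝ) * u i ^ 2 := by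
    rw [Finset.sum_comm]
    refine Finset.sum_congr rfl fun i _ => ?_
    rw [← hrow i]
    exact Finset.sum_congr rfl fun j _ => by rw [G.adj_comm]
  constructor
  · refine div_nonneg (Finset.sum_nonneg fun i _ => Finset.sum_nonneg fun j _ => ?_) zero_le_two
    split_ifs
    · positivity
    · rfl
  · rw [div_le_iff₀ zero_lt_two]
    calc _ ≤ ∑ i, ∑ j, (2 * (if G.Adj i j then u i ^ 2 else 0)
          + 2 * (if G.Adj i j then u j ^ 2 else 0)) := by
          refine Finset.sum_le_sum fun i _ => Finset.sum_le_sum fun j _ => ?_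
          split_ifs
          · nlinarith [sq_nonneg (u i + u j)]
          · simp
      _ = 4 * ∑ i, (G.degree i : ℝ) * u i ^ 2 := by
          simp only [Finset.sum_add_distrib, ← Finset.mul_sum, hcol, hrow]
          ring
      _ ≤ _ := by linarith

lemma dotProduct_gobLaplacian_mulVec (G : SimpleGraph (Fin n)) (v : Fin n → ℝ) :
    v ⬝ᵥ v ≤ v ⬝ᵥ (gobLaplacian G).mulVec v ∧
      v ⬝ᵥ (gobLaplacian G).mulVec v ≤ 3 * (v ⬝ᵥ v) := by
  have h := dotProduct_normalizedLaplacian_mulVec G v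
  rw [gobLaplacian, Matrix.add_mulVec, Matrix.one_mulVec, dotProduct_add]
  constructor <;> linarith

lemma posDef_gobLaplacian (G : SimpleGraph (Fin n)) : (gobLaplacian G).PosDef := by
  refine .of_dotProduct_mulVec_pos
    ((isHermitian_normalizedLaplacian G).add Matrix.isHermitian_one) fun v hv => ?_
  rw [star_trivial]
  refine lt_of_lt_of_le ?_ (dotProduct_gobLaplacian_mulVec G v).1
  simpa using Matrix.dotProduct_star_self_pos_iff.2 hv

/-- The Cauchy–Schwarz inequality for `L` gives `1 ≤ Lᵢᵢ (L⁻¹)ᵢᵢ`, and `Lᵢᵢ ≤ 3`. -/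
lemma card_le_trace_gobLaplacian_inv (G : SimpleGraph (Fin n)) :
    (n : ℝ) / 3 ≤ (gobLaplacian G)⁻¹.trace := by
  have hL := posDef_gobLaplacian G
  have hdiag : ∀ i, (1 : ℝ) / 3 ≤ (gobLaplacian G)⁻¹ i i := by
    intro i
    set L := gobLaplacian G
    set e : Fin n → ℝ := Pi.single i 1 with he
    set p := L⁻¹.mulVec e with hp
    have h1 : L.mulVec p = e := hL.mulVec_inv_mulVec e
    have h2 : e ⬝ᵥ p = L⁻¹ i i := by simp [he, hp]
    have h3 : e ⬝ᵥ e = 1 := by simp [he]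
    have h4 : e ⬝ᵥ L.mulVec e ≤ 3 := by
      have := (dotProduct_gobLaplacian_mulVec G e).2
      rwa [h3, mul_one] at this
    -- the quadratic form of `L` at `p - e / 3` is nonnegative
    have h5 : 0 ≤ (p - (1 / 3 : ℝ) • e) ⬝ᵥ L.mulVec (p - (1 / 3 : ℝ) • e) := by
      simpa using hL.posSemidef.dotProduct_mulVec_nonneg (p - (1 / 3 : ℝ) • e)
    have h6 := hL.isHermitian.dotProduct_mulVec_comm p e
    rw [Matrix.mulVec_sub, Matrix.mulVec_smul, sub_dotProduct, dotProduct_sub, dotProduct_sub,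
      dotProduct_smul, dotProduct_smul, smul_dotProduct, smul_dotProduct, h6, h1,
      dotProduct_comm p e, h2, h3] at h5
    simp only [smul_eq_mul] at h5
    linarith
  calc (n : ℝ) / 3 = ∑ _i : Fin n, (1 : ℝ) / 3 := by simp; ring
    _ ≤ _ := Finset.sum_le_sum fun i _ => hdiag i

variable {d : ℕ}

lemma dotProduct_kronecker_one_mulVec (L : Matrix (Fin n) (Fin n) ℝ) (v : Fin n × Fin d → ℝ) :
    v ⬝ᵥ (L ⊗ₖ (1 : Matrix (Fin d) (Fin d) ℝ)).mulVec v =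
      ∑ k, (fun i => v (i, k)) ⬝ᵥ L.mulVec (fun i => v (i, k)) := by
  simp only [dotProduct, Matrix.mulVec, Fintype.sum_prod_type, Matrix.kroneckerMap_apply,
    Matrix.one_apply, mul_ite, mul_one, mul_zero, ite_mul, zero_mul, Finset.sum_ite_eq,
    Finset.mem_univ, if_true]
  exact Finset.sum_comm

lemma posDef_regularizer {L : Matrix (Fin n) (Fin n) ℝ} (hL : L.PosDef) {lam : ℝ}
    (hlam : 0 < lam) :
    (lam • (L ⊗ₖ (1 : Matrix (Fin d) (Fin d) ℝ))).PosDef :=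
  (hL.kronecker Matrix.PosDef.one).smul hlam

lemma laplacianPenalty_gobLaplacian_le (G : SimpleGraph (Fin n))
    {w : Fin n → EuclideanSpace ℝ (Fin d)} (hw : ∀ i, ‖w i‖ ≤ 1) :
    laplacianPenalty (gobLaplacian G) w ≤ 3 * n := by
  rw [laplacianPenalty, dotProduct_kronecker_one_mulVec]
  calc _ ≤ ∑ k, 3 * ((fun i => stack w (i, k)) ⬝ᵥ fun i => stack w (i, k)) :=
        Finset.sum_le_sum fun k _ => (dotProduct_gobLaplacian_mulVec G _).2
    _ = 3 * ∑ i, ‖w i‖ ^ 2 := by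
        simp only [EuclideanSpace.norm_sq_eq, stack, dotProduct, ← Finset.mul_sum]
        rw [Finset.sum_comm]
        simp [pow_two]
    _ ≤ 3 * ∑ _i : Fin n, 1 := by
        gcongr with i
        exact pow_le_one₀ (norm_nonneg _) (hw i)
    _ = 3 * n := by simp

end Laplacian

/-! ### The regret of a single round -/

/-- The regret incurred in round `t`. -/
noncomputable def roundRegret {Ω : Type*} {n d K : ℕ} (wstar : Fin n → EuclideanSpace ℝ (Fin d))
    (user : ℕ → Ω → Fin n) (x : ℕ → Ω → Fin K → EuclideanSpace ℝ (Fin d))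
    (item : ℕ → Ω → Fin K) (t : ℕ) (ω : Ω) : ℝ :=
  (⨆ j : Fin K, inner ℝ (wstar (user t ω)) (x t ω j))
    - inner ℝ (wstar (user t ω)) (x t ω (item t ω))

section RoundRegret

variable {Ω : Type*} {m0 : MeasurableSpace Ω} {n d K : ℕ}
  {wstar : Fin n → EuclideanSpace ℝ (Fin d)} {user : ℕ → Ω → Fin n}
  {x : ℕ → Ω → Fin K → EuclideanSpace ℝ (Fin d)} {η : ℕ → Ω → Fin K → ℝ}
  {item : ℕ → Ω → Fin K} {west : ℕ → Ω → Fin n → EuclideanSpace ℝ (Fin d)}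
  {μ : Measure Ω} {σ lam δ : ℝ} {L : Matrix (Fin n) (Fin n) ℝ}

lemma roundRegret_nonneg (t : ℕ) (ω : Ω) : 0 ≤ roundRegret wstar user x item t ω :=
  sub_nonneg.2 <| le_ciSup (f := fun j => (inner ℝ (wstar (user t ω)) (x t ω j) : ℝ))
    (Set.finite_range _).bddAbove (item t ω)

lemma roundRegret_le {t : ℕ} {ω : Ω} {B : ℝ} (h : ∀ j, inner ℝ (wstar (user t ω)) (x t ω j) -
    inner ℝ (wstar (user t ω)) (x t ω (item t ω)) ≤ B) : roundRegret wstar user x item t ω ≤ B := by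
  have : Nonempty (Fin K) := ⟨item t ω⟩
  rw [roundRegret, sub_le_iff_le_add]
  exact ciSup_le fun j => by linarith [h j]

lemma ae_roundRegret_le_two (hB : IsGangOfBandits μ σ wstar user x η item) (t : ℕ) :
    ∀ᵐ ω ∂μ, roundRegret wstar user x item t ω ≤ 2 := by
  filter_upwards [hB.norm_features_le t] with ω hω
  refine roundRegret_le fun j => ?_
  have h1 := abs_le.1 (abs_inner_wstar_le (hB.norm_wstar_le (user t ω)) (hω j))
  have h2 := abs_le.1 (abs_inner_wstar_le (hB.norm_wstar_le (user t ω)) (hω (item t ω)))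
  linarith

lemma integrable_roundRegret [IsProbabilityMeasure μ]
    (hB : IsGangOfBandits μ σ wstar user x η item) (hi : ∀ t, Measurable (item t)) (t : ℕ) :
    Integrable (roundRegret wstar user x item t) μ := by
  have h1 : Measurable fun ω => ⨆ j : Fin K, (inner ℝ (wstar (user t ω)) (x t ω j) : ℝ) :=
    Measurable.iSup fun j => (measurable_inner_eval wstar).comp
      ((hB.measurable_user t).prodMk ((hB.measurable_features t).prodMk measurable_const))
  have h2 : Measurable fun ω => (inner ℝ (wstar (user t ω)) (x t ω (item t ω)) : ℝ) :=
    (measurable_inner_eval wstar).comp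
      ((hB.measurable_user t).prodMk ((hB.measurable_features t).prodMk (hi t)))
  refine Integrable.of_bound (h1.sub h2).aestronglyMeasurable 2 ?_
  filter_upwards [ae_roundRegret_le_two hB t] with ω hω
  exact (Real.norm_of_nonneg (roundRegret_nonneg t ω)).trans_le hω

lemma integral_roundRegret_le_two [IsProbabilityMeasure μ]
    (hB : IsGangOfBandits μ σ wstar user x η item) (hi : ∀ t, Measurable (item t)) (t : ℕ) :
    ∫ ω, roundRegret wstar user x item t ω ∂μ ≤ 2 := by
  refine (integral_mono_ae (integrable_roundRegret hB hi t) (integrable_const 2)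
    (ae_roundRegret_le_two hB t)).trans ?_
  simp

/-- Acting greedily on an estimate `w` costs at most the sum of the prediction errors `D` at the
best item and at the chosen one; these are bounded through `2 |D| ≤ D² / c + c`, which keeps the bound
linear in the squared errors. -/
lemma roundRegret_le_sum_sq {t : ℕ} {ω : Ω} (w : Fin n → EuclideanSpace ℝ (Fin d))
    (hgreedy : ∀ j, (inner ℝ (w (user t ω)) (x t ω j) : ℝ) ≤
      inner ℝ (w (user t ω)) (x t ω (item t ω))) {Q : Fin K → ℝ}
    (hQ : ∀ j, ((stack w - stack wstar) ⬝ᵥ userFeature (user t ω) (x t ω j)) ^ 2 ≤ Q j)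
    {c : ℝ} (hc : 0 < c) :
    roundRegret wstar user x item t ω ≤ (∑ j, Q j) / c + c := by
  have herr : ∀ j, |(stack w - stack wstar) ⬝ᵥ userFeature (user t ω) (x t ω j)| ≤
      ((∑ j, Q j) / c + c) / 2 := by
    intro j
    set D := (stack w - stack wstar) ⬝ᵥ userFeature (user t ω) (x t ω j)
    have h1 : D ^ 2 ≤ ∑ j, Q j :=
      (hQ j).trans (Finset.single_le_sum (fun i _ => (sq_nonneg _).trans (hQ i))
        (Finset.mem_univ j))
    have h2 : D ^ 2 / c ≤ (∑ j, Q j) / c := by gcongr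
    have h3 : 2 * |D| ≤ D ^ 2 / c + c := by
      have : 0 ≤ (|D| - c) ^ 2 / c := by positivity
      have e : (|D| - c) ^ 2 / c = D ^ 2 / c + c - 2 * |D| := by
        rw [sub_sq, sq_abs]
        field_simp
        ring
      linarith
    linarith
  refine roundRegret_le fun j => ?_
  have h1 := abs_le.1 (herr j)
  have h2 := abs_le.1 (herr (item t ω))
  simp only [sub_dotProduct, stack_dotProduct_userFeature] at h1 h2
  linarith [hgreedy j]

/-- The exploration rounds before a later round of epoch `q` are the first rounds of the epochs
`1, …, q`. -/
lemma filter_isExploration_eq (L : Matrix (Fin n) (Fin n) ℝ) (lam δ : ℝ) {q t : ℕ}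
    [DecidablePred (IsExploration L lam δ)]
    (h1 : ∀ s < q, epochStart L lam δ s < t) (h2 : t ≤ epochStart L lam δ q) :
    (Finset.range t).filter (IsExploration L lam δ) =
      (Finset.range q).image (epochStart L lam δ) := by
  ext τ
  simp only [Finset.mem_filter, Finset.mem_range, Finset.mem_image, IsExploration]
  constructor
  · rintro ⟨h, s, rfl⟩
    exact ⟨s, (strictMono_epochStart L lam δ).lt_iff_lt.1 (h.trans_le h2), rfl⟩
  · rintro ⟨s, hs, rfl⟩
    exact ⟨h1 s hs, s, rfl⟩

/-- The estimate solves the ridge regression problem with regularizer `λ L ⊗ I` for the sample of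
the exploration rounds. -/
lemma estimate_normal_equation (hL : L.PosDef) (hlam : 0 < lam)
    (hG : IsEpochGreedy μ L lam δ wstar user x η item west) {q t : ℕ}
    (h1 : ∀ s < q, epochStart L lam δ s < t) (h2 : t ≤ epochStart L lam δ q) (ω : Ω)
    (v : Fin n × Fin d → ℝ) :
    ∑ s : Fin q, (stack (west t ω) ⬝ᵥ chosenFeature user x item (epochStart L lam δ s) ω -
        (stack wstar ⬝ᵥ chosenFeature user x item (epochStart L lam δ s) ω
          + η (epochStart L lam δ s) ω (item (epochStart L lam δ s) ω)))
        * (chosenFeature user x item (epochStart L lam δ s) ω ⬝ᵥ v)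
      + v ⬝ᵥ (lam • (L ⊗ₖ (1 : Matrix (Fin d) (Fin d) ℝ))).mulVec (stack (west t ω)) = 0 := by
  have hobj : ∀ w, objective L lam δ wstar user x η item t ω w =
      ∑ s : Fin q, (stack w ⬝ᵥ chosenFeature user x item (epochStart L lam δ s) ω -
        (stack wstar ⬝ᵥ chosenFeature user x item (epochStart L lam δ s) ω
          + η (epochStart L lam δ s) ω (item (epochStart L lam δ s) ω))) ^ 2
      + stack w ⬝ᵥ (lam • (L ⊗ₖ (1 : Matrix (Fin d) (Fin d) ℝ))).mulVec (stack w) := by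
    intro w
    classical
    rw [objective, filter_isExploration_eq L lam δ h1 h2,
      Finset.sum_image (strictMono_epochStart L lam δ).injective.injOn, Finset.sum_range,
      Matrix.smul_mulVec, dotProduct_smul, smul_eq_mul]
    simp only [chosenFeature, stack_dotProduct_userFeature]
    rfl
  refine ridge_normal_equation (posDef_regularizer hL hlam).isHermitian _ _ (fun θ' => ?_) v
  have hw : stack (fun i => WithLp.toLp 2 fun k => θ' (i, k)) = θ' := rfl
  have h3 := hG.estimate t ω (Set.mem_univ (fun i => WithLp.toLp 2 fun k => θ' (i, k)))
  simp only [Set.mem_ofPred_eq, hobj, hw] at h3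
  exact h3

/-- The expected regret of an exploitation round of epoch `q` is bounded by the expected squared
prediction error after `q` exploration rounds, divided by a free parameter `c`, plus `c`. -/
lemma integral_roundRegret_exploit_le [IsProbabilityMeasure μ] {G : SimpleGraph (Fin n)}
    (hlam : 0 < lam) (hB : IsGangOfBandits μ σ wstar user x η item)
    (hG : IsEpochGreedy μ (gobLaplacian G) lam δ wstar user x η item west)
    (hwest : ∀ᵐ ω ∂μ, ∀ t i, ‖west t ω i‖ ≤ 1) {q t : ℕ}
    (h1 : ∀ s < q, epochStart (gobLaplacian G) lam δ s < t)
    (h2 : t < epochStart (gobLaplacian G) lam δ q)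
    {c : ℝ} (hc : 0 < c) :
    ∫ ω, roundRegret wstar user x item t ω ∂μ ≤
      K * ((40 * d * n + 24 * lam * n) / (q + 1)) / c + c := by
  have hΩ : Nonempty Ω := nonempty_of_isProbabilityMeasure μ
  have hK : 0 < K := (item t hΩ.some).pos
  have hmono := strictMono_epochStart (gobLaplacian G) lam δ
  have hexp : ¬ IsExploration (gobLaplacian G) lam δ t := by
    rintro ⟨s, rfl⟩
    exact (h1 s (hmono.lt_iff_lt.1 h2)).false
  have hP := isProbabilityMeasure_exploreLaw hB hK
  have hS := isAdaptedSample_exploration hB hG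
  have hA := posDef_regularizer (d := d) (posDef_gobLaplacian G) hlam
  set L := gobLaplacian G
  set A := lam • (L ⊗ₖ (1 : Matrix (Fin d) (Fin d) ℝ)) with hAdef
  set Y : ℕ → Ω → Fin n × Fin d → ℝ := fun s => chosenFeature user x item (epochStart L lam δ s)
  set ε : ℕ → Ω → ℝ := fun s ω => η (epochStart L lam δ s) ω (item (epochStart L lam δ s) ω)
  set V : Fin K → Ω → Fin n × Fin d → ℝ := fun j ω => userFeature (user t ω) (x t ω j) with hV
  have hVm : ∀ j, Measurable[context user x t] (V j) := fun j => measurable_contextFeature t j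
  obtain ⟨hint, hbound⟩ := hS.integral_sum_freshErrorBound_le hA (stack wstar) q
    (history_le hB hG.measurable_item t)
    (fun i hi => measurable_chosenFeature_history (h1 i hi))
    (fun i hi => measurable_chosenNoise_history (h1 i hi)) hK V
    (fun j => (hVm j).mono (context_le hB t) le_rfl)
    (fun j => indep_of_indep_of_le_right (hB.indep_history t).symm (hVm j).comap_le) (by
      simp only [exploreLaw, hV, map_contextFeature hB t])
  have hbias : stack wstar ⬝ᵥ A.mulVec (stack wstar) ≤ lam * (3 * n) := by
    rw [hAdef, Matrix.smul_mulVec, dotProduct_smul, smul_eq_mul]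
    exact mul_le_mul_of_nonneg_left (laplacianPenalty_gobLaplacian_le G hB.norm_wstar_le) hlam.le
  have hsum : Integrable (fun ω => ∑ j, freshErrorBound A (stack wstar)
      (fun i : Fin q => Y i ω) (fun i => ε i ω) (V j ω)) μ :=
    integrable_finsetSum _ fun j _ => hint j
  have hpoint : ∀ᵐ ω ∂μ, roundRegret wstar user x item t ω ≤
      (∑ j, freshErrorBound A (stack wstar) (fun i : Fin q => Y i ω) (fun i => ε i ω) (V j ω)) / c
        + c := by
    filter_upwards [hwest, hB.norm_features_le t] with ω hw hx
    refine roundRegret_le_sum_sq (west t ω) (hG.exploit t hexp ω) (fun j => ?_) hc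
    refine sq_error_le_freshErrorBound hA _ _ _ _ _
      (estimate_normal_equation (posDef_gobLaplacian G) hlam hG h1 h2.le ω) ?_
    rw [sub_dotProduct, stack_dotProduct_userFeature, stack_dotProduct_userFeature]
    have e1 := abs_le.1 (abs_inner_wstar_le (hB.norm_wstar_le (user t ω)) (hx j))
    have e2 := abs_le.1 (abs_inner_wstar_le (hw t (user t ω)) (hx j))
    exact abs_le.2 ⟨by linarith, by linarith⟩
  refine (integral_mono_ae (integrable_roundRegret hB hG.measurable_item t)
    ((hsum.div_const c).add (integrable_const c)) hpoint).trans ?_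
  have e := integral_add (hsum.div_const c) (integrable_const c)
  simp only [Pi.add_apply] at e ⊢
  rw [e, integral_div]
  simp only [integral_const, probReal_univ, one_smul]
  have hcard : (Fintype.card (Fin n × Fin d) : ℝ) = n * d := by simp
  rw [hcard] at hbound
  have hnum : 8 * (2 ^ 2 + 1) * ((n : ℝ) * d) + 8 * (stack wstar ⬝ᵥ A.mulVec (stack wstar)) ≤
      40 * d * n + 24 * lam * n := by linarith
  have hle := hbound.trans (mul_le_mul_of_nonneg_left
    (div_le_div_of_nonneg_right hnum (by positivity)) (Nat.cast_nonneg K))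
  gcongr

end RoundRegret

/-! ### The length of the epochs and the total regret -/

section Epochs

variable {n : ℕ} {L : Matrix (Fin n) (Fin n) ℝ} {lam δ : ℝ}

/-- The factor of `1 / √q` in `errBound`. -/
noncomputable def errScale (L : Matrix (Fin n) (Fin n) ℝ) (lam δ : ℝ) : ℝ :=
  Real.sqrt (48 * (L⁻¹).trace / lam) + Real.sqrt (9 * Real.log (2 / δ) / 2)

lemma half_le_log_two_div (hδ : 0 < δ) (hδ' : δ < 1) : 1 / 2 ≤ Real.log (2 / δ) := by
  have h1 : Real.log 2 ≤ Real.log (2 / δ) :=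
    Real.log_le_log zero_lt_two (by rw [le_div_iff₀ hδ]; linarith)
  linarith [Real.log_two_gt_d9]

lemma one_le_errScale (hδ : 0 < δ) (hδ' : δ < 1) : 1 ≤ errScale L lam δ := by
  have h : 1 ≤ Real.sqrt (9 * Real.log (2 / δ) / 2) :=
    Real.one_le_sqrt.2 (by linarith [half_le_log_two_div hδ hδ'])
  exact h.trans (le_add_of_nonneg_left (Real.sqrt_nonneg _))

lemma errBound_pos (hδ : 0 < δ) (hδ' : δ < 1) (q : ℕ) : 0 < errBound L lam δ (q + 1) := by
  rw [errBound, ← errScale]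
  exact div_pos (zero_lt_one.trans_le (one_le_errScale hδ hδ')) (Real.sqrt_pos.2 (by positivity))

lemma le_sq_errScale (h : 0 ≤ (L⁻¹).trace / lam) :
    48 * ((L⁻¹).trace / lam) ≤ errScale L lam δ ^ 2 := by
  have h1 : Real.sqrt (48 * (L⁻¹).trace / lam) ^ 2 = 48 * ((L⁻¹).trace / lam) := by
    rw [Real.sq_sqrt (by rw [mul_div_assoc]; positivity), mul_div_assoc]
  rw [← h1]
  exact pow_le_pow_left₀ (Real.sqrt_nonneg _) (le_add_of_nonneg_right (Real.sqrt_nonneg _)) 2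

lemma sq_errScale_le (h : 0 ≤ (L⁻¹).trace / lam) (hl : 0 ≤ Real.log (2 / δ)) :
    errScale L lam δ ^ 2 ≤ 96 * ((L⁻¹).trace / lam) + 9 * Real.log (2 / δ) := by
  have h1 : Real.sqrt (48 * (L⁻¹).trace / lam) ^ 2 = 48 * ((L⁻¹).trace / lam) := by
    rw [Real.sq_sqrt (by rw [mul_div_assoc]; positivity), mul_div_assoc]
  have h2 : Real.sqrt (9 * Real.log (2 / δ) / 2) ^ 2 = 9 * Real.log (2 / δ) / 2 :=
    Real.sq_sqrt (by positivity)
  unfold errScale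
  nlinarith [sq_nonneg (Real.sqrt (48 * (L⁻¹).trace / lam) - Real.sqrt (9 * Real.log (2 / δ) / 2))]

lemma two_thirds_mul_sqrt_step (q : ℕ) :
    2 / 3 * ((q + 1 : ℕ) * Real.sqrt (q + 1 : ℕ)) ≤
      2 / 3 * (q * Real.sqrt q) + Real.sqrt (q + 1 : ℕ) := by
  have hu := Real.sqrt_nonneg ((q + 1 : ℕ) : ℝ)
  have hv := Real.sqrt_nonneg (q : ℝ)
  have hu2 := Real.sq_sqrt (Nat.cast_nonneg (α := ℝ) (q + 1))
  have hv2 := Real.sq_sqrt (Nat.cast_nonneg (α := ℝ) q)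
  have hvu : Real.sqrt q ≤ Real.sqrt (q + 1 : ℕ) := Real.sqrt_le_sqrt (by push_cast; linarith)
  set u := Real.sqrt (q + 1 : ℕ)
  set v := Real.sqrt q
  have h1 : u ^ 2 - v ^ 2 = 1 := by rw [hu2, hv2]; push_cast; ring
  rw [← hu2, ← hv2]
  have h2 : u = u * (u ^ 2 - v ^ 2) := by rw [h1, mul_one]
  -- `3 u (u² - v²) - 2 (u³ - v³) = (u - v) (u² + u v - 2 v²) = (u - v)² (u + 2 v)`
  have h4 : 0 ≤ (u - v) ^ 2 * (u + 2 * v) := by positivity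
  nlinarith

/-- `q` epochs take at least of the order of `q ^ (3/2)` rounds. -/
lemma le_errScale_mul_epochStart (ha : 0 < errScale L lam δ) (q : ℕ) :
    2 / 3 * (q * Real.sqrt q) ≤ errScale L lam δ * epochStart L lam δ q := by
  induction q with
  | zero => simp [epochStart]
  | succ q ih =>
    have h1 : Real.sqrt (q + 1 : ℕ) / errScale L lam δ ≤
        (1 + exploitSteps L lam δ (q + 1) : ℕ) := by
      have e : 1 / errBound L lam δ (q + 1) = Real.sqrt (q + 1 : ℕ) / errScale L lam δ := by
        rw [errBound, ← errScale, one_div_div]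
      rw [← e, exploitSteps]
      push_cast
      linarith [Nat.lt_floor_add_one (1 / errBound L lam δ (q + 1))]
    rw [div_le_iff₀ ha] at h1
    have h2 : epochStart L lam δ (q + 1) =
        epochStart L lam δ q + (1 + exploitSteps L lam δ (q + 1)) := by
      rw [epochStart, epochStart, Finset.sum_range_succ]
    rw [h2, Nat.cast_add (epochStart L lam δ q), mul_add]
    linarith [two_thirds_mul_sqrt_step q]

/-- If the first `q` epochs take fewer than `T` rounds, then `q + 1` is of order `T ^ (2/3)`. -/
lemma succ_le_of_epochStart_lt (ha : 1 ≤ errScale L lam δ) {q T : ℕ}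
    (hT : epochStart L lam δ q < T) :
    ((q + 1 : ℕ) : ℝ) ≤ 3 * (errScale L lam δ * T) ^ (2 / 3 : ℝ) := by
  have hT1 : (1 : ℝ) ≤ T := by exact_mod_cast Nat.one_le_of_lt hT
  have hT' : (epochStart L lam δ q : ℝ) ≤ T := by exact_mod_cast hT.le
  have haT : 1 ≤ errScale L lam δ * T := by nlinarith
  have h1 := le_errScale_mul_epochStart (by linarith) (L := L) (lam := lam) (δ := δ) q
  have h2 : (q : ℝ) * Real.sqrt q ≤ 3 / 2 * (errScale L lam δ * T) := by nlinarith
  have h3 : (q : ℝ) = (q * Real.sqrt q) ^ (2 / 3 : ℝ) := by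
    have hq : (0 : ℝ) ≤ q := Nat.cast_nonneg q
    rcases hq.eq_or_lt with h | h
    · rw [← h]; simp
    · nth_rewrite 2 [← Real.rpow_one (q : ℝ)]
      rw [Real.sqrt_eq_rpow, ← Real.rpow_add h, ← Real.rpow_mul hq]
      norm_num
  have h4 : (q : ℝ) ≤ 3 / 2 * (errScale L lam δ * T) ^ (2 / 3 : ℝ) := by
    rw [h3]
    refine (Real.rpow_le_rpow (by positivity) h2 (by norm_num)).trans ?_
    rw [Real.mul_rpow (by norm_num) (by linarith)]
    gcongr
    exact Real.rpow_le_self_of_one_le (by norm_num) (by norm_num)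
  have h5 : 1 ≤ (errScale L lam δ * T) ^ (2 / 3 : ℝ) := Real.one_le_rpow haT (by norm_num)
  push_cast
  linarith

lemma rpow_errScale_mul_le {lamMax : ℝ} {n : ℕ} (hn : 0 < n) (G : SimpleGraph (Fin n))
    {lam δ : ℝ} (hlam : 0 < lam) (hle : lam ≤ lamMax) (hδ : 0 < δ) (hδ' : δ < 1) (T : ℕ) :
    (errScale (gobLaplacian G) lam δ * T) ^ (2 / 3 : ℝ) ≤
      (192 + 27 * lamMax) ^ (1 / 3 : ℝ) * (Real.log (2 / δ)) ^ (1 / 3 : ℝ) *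
        ((n : ℝ) ^ (1 / 3 : ℝ) *
          (((gobLaplacian G)⁻¹).trace / (lam * n)) ^ (1 / 3 : ℝ) * (T : ℝ) ^ (2 / 3 : ℝ)) := by
  have hn' : (1 : ℝ) ≤ n := by exact_mod_cast hn
  have htr := card_le_trace_gobLaplacian_inv G
  have hl := half_le_log_two_div hδ hδ'
  have ha := one_le_errScale (L := gobLaplacian G) (lam := lam) hδ hδ'
  set R := ((gobLaplacian G)⁻¹).trace / lam with hR
  have hR1 : 1 ≤ 3 * lamMax * R := by
    have h1 : R * lam = ((gobLaplacian G)⁻¹).trace := div_mul_cancel₀ _ hlam.ne'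
    have h2 : 0 ≤ R := div_nonneg (by linarith) hlam.le
    nlinarith
  have hR0 : 0 ≤ R := div_nonneg (by linarith) hlam.le
  have hmax : 0 < lamMax := hlam.trans_le hle
  have h1 : errScale (gobLaplacian G) lam δ ^ 2 ≤ (192 + 27 * lamMax) * Real.log (2 / δ) * R := by
    have := sq_errScale_le (δ := δ) hR0 (by linarith)
    nlinarith [mul_le_mul_of_nonneg_right hl hR0]
  have h2 : (n : ℝ) ^ (1 / 3 : ℝ) * (((gobLaplacian G)⁻¹).trace / (lam * n)) ^ (1 / 3 : ℝ) =
      R ^ (1 / 3 : ℝ) := by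
    rw [← Real.mul_rpow (by linarith) (div_nonneg (by linarith) (by positivity))]
    congr 1
    rw [hR]
    field_simp
  have h3 : errScale (gobLaplacian G) lam δ ^ (2 / 3 : ℝ) =
      (errScale (gobLaplacian G) lam δ ^ 2) ^ (1 / 3 : ℝ) := by
    rw [← Real.rpow_natCast, ← Real.rpow_mul (by linarith)]
    norm_num
  rw [Real.mul_rpow (by linarith) (Nat.cast_nonneg T), h2, h3, ← mul_assoc]
  gcongr
  rw [← Real.mul_rpow (by positivity) (by linarith), ← Real.mul_rpow (by positivity) hR0]
  exact Real.rpow_le_rpow (by positivity) h1 (by norm_num)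

end Epochs

section TotalRegret

variable {Ω : Type*} {m0 : MeasurableSpace Ω} {n d K : ℕ}
  {wstar : Fin n → EuclideanSpace ℝ (Fin d)} {user : ℕ → Ω → Fin n}
  {x : ℕ → Ω → Fin K → EuclideanSpace ℝ (Fin d)} {η : ℕ → Ω → Fin K → ℝ}
  {item : ℕ → Ω → Fin K} {west : ℕ → Ω → Fin n → EuclideanSpace ℝ (Fin d)}
  {μ : Measure Ω} [IsProbabilityMeasure μ] {σ lam δ lamMax : ℝ} {G : SimpleGraph (Fin n)}

/-- The expected regret of an exploitation round of epoch `q + 1` is of the order of `errBound` at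
`q + 1`. -/
lemma integral_roundRegret_le_errBound (hlam : 0 < lam) (hle : lam ≤ lamMax) (hδ : 0 < δ)
    (hδ' : δ < 1) (hB : IsGangOfBandits μ σ wstar user x η item)
    (hG : IsEpochGreedy μ (gobLaplacian G) lam δ wstar user x η item west)
    (hwest : ∀ᵐ ω ∂μ, ∀ t i, ‖west t ω i‖ ≤ 1) {q t : ℕ}
    (h1 : epochStart (gobLaplacian G) lam δ q < t)
    (h2 : t < epochStart (gobLaplacian G) lam δ (q + 1)) :
    ∫ ω, roundRegret wstar user x item t ω ∂μ ≤
      (K * ((40 * d + 24 * lamMax) * lamMax) + 1) * errBound (gobLaplacian G) lam δ (q + 1) := by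
  have hmono := (strictMono_epochStart (gobLaplacian G) lam δ).monotone
  have hq : (0 : ℝ) < ((q + 1 : ℕ) : ℝ) := by positivity
  have hc := errBound_pos (L := gobLaplacian G) (lam := lam) hδ hδ' q
  refine (integral_roundRegret_exploit_le hlam hB hG hwest
    (fun s hs => (hmono (Nat.lt_succ_iff.1 hs)).trans_lt h1) h2 hc).trans ?_
  have hc2 : errBound (gobLaplacian G) lam δ (q + 1) ^ 2 =
      errScale (gobLaplacian G) lam δ ^ 2 / (q + 1 : ℕ) := by
    rw [errBound, ← errScale, div_pow, Real.sq_sqrt hq.le]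
  set c := errBound (gobLaplacian G) lam δ (q + 1)
  have htr := card_le_trace_gobLaplacian_inv G
  have hn : (0 : ℝ) ≤ n := Nat.cast_nonneg n
  have hR0 : 0 ≤ ((gobLaplacian G)⁻¹).trace / lam := div_nonneg (by linarith) hlam.le
  have hmax : 0 < lamMax := hlam.trans_le hle
  -- the trace of `L⁻¹` is at least `n / 3`, so the dimension `n d` is absorbed by the tuning
  have hn2 : (n : ℝ) ≤ lamMax * errScale (gobLaplacian G) lam δ ^ 2 := by
    have h3 := le_sq_errScale (δ := δ) hR0
    have h4 : ((gobLaplacian G)⁻¹).trace / lam * lam = ((gobLaplacian G)⁻¹).trace :=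
      div_mul_cancel₀ _ hlam.ne'
    calc (n : ℝ) ≤ lam * (48 * (((gobLaplacian G)⁻¹).trace / lam)) := by linarith
      _ ≤ lamMax * errScale (gobLaplacian G) lam δ ^ 2 := by gcongr
  have hq1 : ((q + 1 : ℕ) : ℝ) ≤ ((q + 1 : ℕ) : ℝ) + 1 := by linarith
  have h5 : (40 * d * n + 24 * lam * n) / (((q + 1 : ℕ) : ℝ) + 1) ≤
      (40 * d + 24 * lamMax) * lamMax * c ^ 2 := by
    rw [hc2, ← mul_div_assoc]
    gcongr
    calc 40 * (d : ℝ) * n + 24 * lam * n = (40 * d + 24 * lam) * n := by ring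
      _ ≤ (40 * d + 24 * lamMax) * (lamMax * errScale (gobLaplacian G) lam δ ^ 2) := by gcongr
      _ = _ := by ring
  calc _ ≤ K * ((40 * d + 24 * lamMax) * lamMax * c ^ 2) / c + c := by gcongr
    _ = _ := by field_simp

/-- Every epoch contributes a bounded amount to the expected regret, because it has at most
`1 / errBound` exploitation rounds. -/
lemma sum_integral_roundRegret_le (hlam : 0 < lam) (hle : lam ≤ lamMax) (hδ : 0 < δ)
    (hδ' : δ < 1) (hB : IsGangOfBandits μ σ wstar user x η item)
    (hG : IsEpochGreedy μ (gobLaplacian G) lam δ wstar user x η item west)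
    (hwest : ∀ᵐ ω ∂μ, ∀ t i, ‖west t ω i‖ ≤ 1) (q : ℕ) :
    ∑ t ∈ Finset.range (epochStart (gobLaplacian G) lam δ q),
      ∫ ω, roundRegret wstar user x item t ω ∂μ ≤
      q * (K * ((40 * d + 24 * lamMax) * lamMax) + 3) := by
  induction q with
  | zero => simp [epochStart]
  | succ q ih =>
    have hs : epochStart (gobLaplacian G) lam δ (q + 1) =
        epochStart (gobLaplacian G) lam δ q +
          (exploitSteps (gobLaplacian G) lam δ (q + 1) + 1) := by
      rw [epochStart, epochStart, Finset.sum_range_succ, add_comm 1]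
    have hc := errBound_pos (L := gobLaplacian G) (lam := lam) hδ hδ' q
    have hmax : 0 < lamMax := hlam.trans_le hle
    have hsteps : (exploitSteps (gobLaplacian G) lam δ (q + 1) : ℝ) *
        errBound (gobLaplacian G) lam δ (q + 1) ≤ 1 := by
      rw [← le_div_iff₀ hc]
      exact Nat.floor_le (by positivity)
    have hexploit : ∑ i ∈ Finset.range (exploitSteps (gobLaplacian G) lam δ (q + 1)),
        ∫ ω, roundRegret wstar user x item (epochStart (gobLaplacian G) lam δ q + (i + 1)) ω ∂μ ≤
        K * ((40 * d + 24 * lamMax) * lamMax) + 1 := by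
      calc _ ≤ ∑ _i ∈ Finset.range (exploitSteps (gobLaplacian G) lam δ (q + 1)),
            (K * ((40 * d + 24 * lamMax) * lamMax) + 1) *
              errBound (gobLaplacian G) lam δ (q + 1) := by
            refine Finset.sum_le_sum fun i hi => ?_
            have hi' := Finset.mem_range.1 hi
            exact integral_roundRegret_le_errBound hlam hle hδ hδ' hB hG hwest (q := q)
              (by omega) (by omega)
        _ = (K * ((40 * d + 24 * lamMax) * lamMax) + 1) *
              (exploitSteps (gobLaplacian G) lam δ (q + 1) *
                errBound (gobLaplacian G) lam δ (q + 1)) := by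
            rw [Finset.sum_const, Finset.card_range, nsmul_eq_mul]
            ring
        _ ≤ (K * ((40 * d + 24 * lamMax) * lamMax) + 1) * 1 := by gcongr
        _ = _ := mul_one _
    have hexplore := integral_roundRegret_le_two hB hG.measurable_item
      (epochStart (gobLaplacian G) lam δ q)
    rw [hs, Finset.sum_range_add, Finset.sum_range_succ']
    push_cast
    rw [add_zero]
    linarith

end TotalRegret

theorem theorem1 (d K : ℕ) (lamMax : ℝ) :
    ∃ C : ℝ, 0 < C ∧
      ∀ (n : ℕ) (G : SimpleGraph (Fin n)) (lam δ σ : ℝ),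
        0 < lam → lam ≤ lamMax → 0 < δ → δ < 1 →
      ∀ (Ω : Type*) [MeasurableSpace Ω] (μ : Measure Ω) [IsProbabilityMeasure μ]
        (wstar : Fin n → EuclideanSpace ℝ (Fin d)) (user : ℕ → Ω → Fin n)
        (x : ℕ → Ω → Fin K → EuclideanSpace ℝ (Fin d)) (η : ℕ → Ω → Fin K → ℝ)
        (item : ℕ → Ω → Fin K) (west : ℕ → Ω → Fin n → EuclideanSpace ℝ (Fin d)),
        IsGangOfBandits μ σ wstar user x η item →
        IsEpochGreedy μ (gobLaplacian G) lam δ wstar user x η item west →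
        (∀ᵐ ω ∂μ, ∀ t i, ‖west t ω i‖ ≤ 1) →
        ∀ T : ℕ,
          ∫ ω, regret wstar user x item T ω ∂μ ≤
            C * (Real.log (2 / δ)) ^ (1 / 3 : ℝ) *
              ((n : ℝ) ^ (1 / 3 : ℝ) *
                (((gobLaplacian G)⁻¹).trace / (lam * n)) ^ (1 / 3 : ℝ) *
                (T : ℝ) ^ (2 / 3 : ℝ)) := by
  refine ⟨3 * (K * ((40 * d + 24 * |lamMax|) * |lamMax|) + 3) * (192 + 27 * |lamMax|) ^ (1 / 3 : ℝ),
    by positivity, ?_⟩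
  intro n G lam δ σ hlam hle hδ hδ' Ω _ μ _ wstar user x η item west hB hG hwest T
  have hle' : lam ≤ |lamMax| := hle.trans (le_abs_self _)
  have hΩ : Nonempty Ω := nonempty_of_isProbabilityMeasure μ
  have hn : 0 < n := (user 0 hΩ.some).pos
  rcases Nat.eq_zero_or_pos T with rfl | hT
  · simp [regret]
  have ha := one_le_errScale (L := gobLaplacian G) (lam := lam) hδ hδ'
  -- `q + 1` is the number of epochs begun in the first `T` rounds
  obtain ⟨q, hq1, hq2⟩ : ∃ q, epochStart (gobLaplacian G) lam δ q < T ∧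
      T ≤ epochStart (gobLaplacian G) lam δ (q + 1) := by
    have hex : ∃ q, T ≤ epochStart (gobLaplacian G) lam δ q :=
      ⟨T, (strictMono_epochStart (gobLaplacian G) lam δ).le_apply⟩
    classical
    have hpos : Nat.find hex ≠ 0 := by
      intro h0
      have := Nat.find_spec hex
      rw [h0] at this
      simp [epochStart] at this
      omega
    obtain ⟨q, hq⟩ := Nat.exists_eq_succ_of_ne_zero hpos
    refine ⟨q, not_le.1 (Nat.find_min hex (by omega)), ?_⟩
    have := Nat.find_spec hex
    rwa [hq] at this
  have hregret : ∫ ω, regret wstar user x item T ω ∂μ =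
      ∑ t ∈ Finset.range T, ∫ ω, roundRegret wstar user x item t ω ∂μ :=
    integral_finsetSum _ fun t _ => integrable_roundRegret hB hG.measurable_item t
  rw [hregret]
  calc _ ≤ ∑ t ∈ Finset.range (epochStart (gobLaplacian G) lam δ (q + 1)),
        ∫ ω, roundRegret wstar user x item t ω ∂μ :=
        Finset.sum_le_sum_of_subset_of_nonneg (Finset.range_mono hq2) fun t _ _ =>
          integral_nonneg fun ω => roundRegret_nonneg t ω
    _ ≤ ((q + 1 : ℕ) : ℝ) * (K * ((40 * d + 24 * |lamMax|) * |lamMax|) + 3) :=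
        sum_integral_roundRegret_le hlam hle' hδ hδ' hB hG hwest (q + 1)
    _ ≤ (3 * ((192 + 27 * |lamMax|) ^ (1 / 3 : ℝ) * (Real.log (2 / δ)) ^ (1 / 3 : ℝ) *
        ((n : ℝ) ^ (1 / 3 : ℝ) * (((gobLaplacian G)⁻¹).trace / (lam * n)) ^ (1 / 3 : ℝ) *
          (T : ℝ) ^ (2 / 3 : ℝ)))) * (K * ((40 * d + 24 * |lamMax|) * |lamMax|) + 3) := by
        gcongr
        refine (succ_le_of_epochStart_lt ha hq1).trans ?_
        gcongr
        exact rpow_errScale_mul_le hn G hlam hle' hδ hδ' T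
    _ = _ := by ring
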